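/- Rings are commutative with unit. A derivation $D$ of a ring $R$ is \emph{locally nilpotent} if for every $r\in R$ there is $n>0$ with $D^n(r)=0$; $R$ is \emph{rigid} if $0$ is its only locally nilpotent derivation, and \emph{non-rigid} otherwise. Let $B=\bigoplus_{i\in\mathbb Z}B_i$ be a $\mathbb Z$-graded integral domain. For $d\ge 1$ put $B^{(d)}=\bigoplus_{i\in\mathbb Z}B_{di}$, a subring of $B$. An element $f\in B$ is \emph{cylindrical} if it is nonzero and homogeneous of nonzero degree, and the degree-$0$ subring $B_{(f)}$ of the graded ring $B_f=B[1/f]$ is a polynomial ring in one variable over some subring of $B_{(f)}$. The \emph{saturation index} of $B$ is $e(B)=\gcd\{i\in\mathbb Z : B_i\neq 0\}$, and $B$ is \emph{saturated in codimension $1$} if $e(B/\mathfrak p)=e(B)$ for every homogeneous prime ideal $\mathfrak p$ of $B$ of height $1$, where $B/\mathfrak p$ carries the induced grading. \textbf{Theorem.} Let $B=\bigoplus_{i\in\mathbb Z}B_i$ be a $\mathbb Z$-graded integral domain that is finitely generated as an algebra over a field of characteristic $0$, and assume that at least one of the following holds: (i) the transcendence degree of $B$ over $B_0$ is at least $2$;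 (ii) there exist $i<0<j$ with $B_i\neq 0$ and $B_j\neq 0$. (1) The following are equivalent: (a) there exists $d\ge 1$ such that $B^{(d)}$ is non-rigid; (b) $B$ has a cylindrical element. (2) If $B$ is normal (integrally closed in its field of fractions) and saturated in codimension $1$, then (a) and (b) are also equivalent to: (c) $B$ is non-rigid. -/

import Mathlib

/-- A derivation `D : B → B` is locally nilpotent if each element is killed by some power of `D`. -/
def IsLocallyNilpotentDerivation {B : Type*} [CommRing B] (D : Derivation ℤ B B) : Prop :=
  ∀ b : B, ∃ n : ℕ, 0 < n ∧ (⇑D)^[n] b = 0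

/-- A ring is rigid if its only locally nilpotent derivation is zero. -/
def IsRigidRing (B : Type*) [CommRing B] : Prop :=
  ∀ D : Derivation ℤ B B, IsLocallyNilpotentDerivation D → D = 0

/-- `R` is a polynomial ring in one variable (over some subring of itself). -/
def IsPolynomialRingInOneVariable (R : Type*) [CommRing R] : Prop :=
  ∃ A : Subring R, Nonempty (R ≃ₐ[A] Polynomial A)

section Graded

variable {B : Type*} [CommRing B]

/-- The Veronese subring `B^(d) = ⨁ i, B_{di}` of a `ℤ`-graded ring `B`. -/
def veroneseSubring (𝒜 : ℤ → AddSubgroup B) [GradedRing 𝒜] (d : ℤ) : Subring B where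
  carrier := ((⨆ i : ℤ, 𝒜 (d * i) : AddSubgroup B) : Set B)
  zero_mem' := zero_mem (⨆ i : ℤ, 𝒜 (d * i))
  add_mem' := fun ha hb => add_mem (S := AddSubgroup B) ha hb
  neg_mem' := fun ha => neg_mem (S := AddSubgroup B) ha
  one_mem' := AddSubgroup.mem_iSup_of_mem 0 (by
    rw [mul_zero]; exact SetLike.GradedOne.one_mem)
  mul_mem' := by
    intro a b ha hb
    change a ∈ (⨆ i : ℤ, 𝒜 (d * i)) at ha
    change b ∈ (⨆ i : ℤ, 𝒜 (d * i)) at hb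
    change a * b ∈ (⨆ i : ℤ, 𝒜 (d * i))
    induction ha using AddSubgroup.iSup_induction' with
    | hp i x hx =>
      induction hb using AddSubgroup.iSup_induction' with
      | hp j y hy =>
        refine AddSubgroup.mem_iSup_of_mem (i + j) ?_
        rw [mul_add]
        exact SetLike.GradedMul.mul_mem hx hy
      | h1 => rw [mul_zero]; exact zero_mem _
      | hadd y z _ _ hy hz => rw [mul_add]; exact add_mem hy hz
    | h1 => rw [zero_mul]; exact zero_mem _
    | hadd x y _ _ hx hy => rw [add_mul]; exact add_mem hx hy

/-- An element `f` of a `ℤ`-graded ring is cylindrical if it is nonzero, homogeneous of nonzero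
degree, and the degree-`0` subring `B_(f)` of `B_f` is a polynomial ring in one variable. -/
def IsCylindrical (𝒜 : ℤ → AddSubgroup B) [GradedRing 𝒜] (f : B) : Prop :=
  f ≠ 0 ∧ (∃ i : ℤ, i ≠ 0 ∧ f ∈ 𝒜 i) ∧
    IsPolynomialRingInOneVariable (HomogeneousLocalization.Away 𝒜 f)

/-- The saturation index `gcd {i ∈ ℤ | B_i ≠ 0}` of a grading, as the nonnegative generator of the
ideal of `ℤ` generated by the degrees that occur. -/
noncomputable def saturationIndex (𝒜 : ℤ → AddSubgroup B) : ℕ :=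
  (Submodule.IsPrincipal.generator (Ideal.span {i : ℤ | 𝒜 i ≠ ⊥})).natAbs

/-- The saturation index is the greatest common divisor of the degrees that occur. -/
theorem dvd_saturationIndex_iff (𝒜 : ℤ → AddSubgroup B) (m : ℤ) :
    m ∣ (saturationIndex 𝒜 : ℤ) ↔ ∀ i : ℤ, 𝒜 i ≠ ⊥ → m ∣ i := by
  rw [saturationIndex, Int.dvd_natAbs, ← Ideal.mem_span_singleton,
    ← Ideal.span_singleton_le_iff_mem, Ideal.span_singleton_generator, Ideal.span_le]
  simp only [Set.subset_def, Set.mem_ofPred_eq, SetLike.mem_coe, Ideal.mem_span_singleton]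

/-- The grading of `B / p` induced by that of `B`: `(B / p)_i` is the image of `B_i`. -/
def quotientGrading (𝒜 : ℤ → AddSubgroup B) (p : Ideal B) : ℤ → AddSubgroup (B ⧸ p) :=
  fun i => (𝒜 i).map (Ideal.Quotient.mk p).toAddMonoidHom

/-- `B` is saturated in codimension `1` if `e(B / p) = e(B)` for every homogeneous prime ideal `p`
of `B` of height `1`. -/
def IsSaturatedInCodimOne (𝒜 : ℤ → AddSubgroup B) [GradedRing 𝒜] : Prop :=
  ∀ p : Ideal B, p.IsPrime → p.IsHomogeneous 𝒜 → p.height = 1 →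
    saturationIndex (quotientGrading 𝒜 p) = saturationIndex 𝒜

end Graded

/-! Everything is computed in the fraction field K of B, where derivations of the various subrings
become comparable.

From a non-rigid Veronese subring to a cylinder: the subring is of finite type over the ground
field, so the top homogeneous component of a nonzero locally nilpotent derivation exists and is
again locally nilpotent. It extends to a derivation δ of K. A local slice t, with δt = a ≠ 0 and δa
= 0, gives s = t/a with δs = 1, and every homogeneous element of the Veronese subring is a
polynomial in s with homogeneous constant coefficients. Either size hypothesis on B forces a nonzero
constant of nonzero degree. Hence some s^m becomes homogeneous of degree 0 after division by a
fraction u of constants. With m minimal and f a suitable product of constants, B_(f) is a polynomial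
ring in s^m/u (`IsHomogeneousLND.exists_isPolynomialRing`).

From a cylinder f of degree n back: f is transcendental over B_(f), and K is algebraic over
B_(f)[f], so d/dt on B_(f) = A[t] extends to a derivation δ of K with δf = 0. For large N, finite
generation makes Δ = f^N δ preserve B^(|n|), where it is nonzero and locally nilpotent.

If B is normal and saturated in codimension 1, the same Δ preserves B. A value Δb outside B would
have all its denominators in a height-one prime p (`exists_prime_height_one_of_notMem_range`).
Saturation supplies a homogeneous z outside p that moves b into the Veronese subring, and the
Leibniz rule then makes a power of z a denominator of Δb, a contradiction. Local nilpotency on B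
follows because Δ lowers the t-degree attached to |n|-th powers of homogeneous elements. -/

/-- A derivation of a domain of characteristic zero extends to any field that is algebraic
over it. -/
theorem Derivation.exists_extend_of_isAlgebraic {R K : Type*} [CommRing R] [IsDomain R] [Field K]
    [CharZero K] [Algebra R K] [Algebra.IsAlgebraic R K]
    (hinj : Function.Injective (algebraMap R K)) (D : Derivation ℤ R K) :
    ∃ D' : Derivation ℤ K K, ∀ r, D' (algebraMap R K r) = D r := by
  have : FaithfulSMul R K := (faithfulSMul_iff_algebraMap_injective R K).2 hinj
  let F := FractionRing R
  let _ : Algebra F K := FractionRing.liftAlgebra R K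
  have : IsScalarTower R F K := FractionRing.isScalarTower_liftAlgebra R K
  have : CharZero F := (algebraMap F K).charZero
  have : Algebra.IsAlgebraic F K := (IsFractionRing.comap_isAlgebraic_iff (A := R) (K := F)).1 ‹_›
  -- Algebraic extensions in characteristic zero are separable, hence formally étale, as are
  -- localizations. So the differentials of K are the base change of those of R, and derivations
  -- into K extend.
  have : Algebra.FormallyEtale F K := Algebra.FormallyEtale.of_isSeparable F K
  have : Algebra.FormallyEtale R F := Algebra.FormallyEtale.of_isLocalization (nonZeroDivisors R)
  have : Algebra.FormallyEtale R K := Algebra.FormallyEtale.comp R F K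
  have hbc := KaehlerDifferential.isBaseChange_of_formallyEtale ℤ R K
  let g := hbc.lift D.liftKaehlerDifferential
  refine ⟨g.compDer (KaehlerDifferential.D ℤ K), fun r => ?_⟩
  have h := hbc.lift_eq D.liftKaehlerDifferential (KaehlerDifferential.D ℤ R r)
  rw [KaehlerDifferential.map_D, Derivation.liftKaehlerDifferential_comp_D] at h
  exact h

/-- The Leibniz rule for the highest iterate that does not vanish on a product. -/
theorem Derivation.iterate_mul_of_iterate_eq_zero {R : Type*} [CommRing R] (D : Derivation ℤ R R) :
    ∀ (s m n : ℕ), m + n = s → ∀ x y : R, D^[m + 1] x = 0 → D^[n + 1] y = 0 →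
      D^[s] (x * y) = (s.choose m : R) * (D^[m] x * D^[n] y) := by
  intro s
  induction s with
  | zero =>
    intro m n h x y hx hy
    obtain ⟨rfl, rfl⟩ : m = 0 ∧ n = 0 := by omega
    simp
  | succ s ih =>
    intro m n h x y hx hy
    have hadd : ∀ (q : ℕ) (a b : R), D^[q] (a + b) = D^[q] a + D^[q] b := fun q a b =>
      iterate_map_add D q a b
    have hz : ∀ q : ℕ, D^[q] (0 : R) = 0 := fun q => iterate_map_zero D q
    rw [Function.iterate_succ_apply, Derivation.leibniz, hadd, smul_eq_mul, smul_eq_mul]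
    rcases m with _ | m
    · obtain rfl : n = s + 1 := by omega
      have hx' : D x = 0 := by simpa using hx
      rw [hx', mul_zero, hz, add_zero, ih 0 s (by omega) x (D y) (by simpa using hx)
        (by rw [← Function.iterate_succ_apply]; exact hy), ← Function.iterate_succ_apply]
      simp
    rcases n with _ | n
    · obtain rfl : m = s := by omega
      have hy' : D y = 0 := by simpa using hy
      rw [hy', mul_zero, hz, zero_add, mul_comm, ih m 0 (by omega) (D x) y
        (by rw [← Function.iterate_succ_apply]; exact hx) (by simpa using hy),
        ← Function.iterate_succ_apply]
      simp
    · rw [ih (m + 1) n (by omega) x (D y) hx (by rw [← Function.iterate_succ_apply]; exact hy),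
        mul_comm y (D x),
        ih m (n + 1) (by omega) (D x) y (by rw [← Function.iterate_succ_apply]; exact hx) hy,
        ← Function.iterate_succ_apply, ← Function.iterate_succ_apply, Nat.choose_succ_succ]
      push_cast
      ring

/-- A locally nilpotent derivation of a domain of characteristic zero kills the units. -/
theorem IsLocallyNilpotentDerivation.apply_eq_zero_of_mul_eq_one {R : Type*} [CommRing R]
    [IsDomain R] [CharZero R] {D : Derivation ℤ R R} (hD : IsLocallyNilpotentDerivation D)
    {u v : R} (huv : u * v = 1) : D u = 0 := by
  classical
  have key : ∀ x : R, x ≠ 0 → ∃ m, D^[m] x ≠ 0 ∧ D^[m + 1] x = 0 := by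
    intro x hx
    obtain ⟨n, hn, h⟩ := hD x
    have hex : ∃ n, D^[n] x = 0 := ⟨n, h⟩
    have h0 : Nat.find hex ≠ 0 := fun h0 => hx (by simpa [h0] using Nat.find_spec hex)
    refine ⟨Nat.find hex - 1, Nat.find_min hex (by omega), ?_⟩
    rw [Nat.sub_add_cancel (by omega)]
    exact Nat.find_spec hex
  obtain ⟨m, hm, hm'⟩ := key u (left_ne_zero_of_mul_eq_one huv)
  obtain ⟨n, hn, hn'⟩ := key v (right_ne_zero_of_mul_eq_one huv)
  -- The right side is nonzero in characteristic zero, while uv = 1 is killed by the first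
  -- application of D. So m + n = 0.
  have h := D.iterate_mul_of_iterate_eq_zero (m + n) m n rfl u v hm' hn'
  rcases m with _ | m
  · simpa using hm'
  · exfalso
    rw [huv, show m + 1 + n = (m + n) + 1 by omega, Function.iterate_succ_apply,
      Derivation.map_one_eq_zero, iterate_map_zero] at h
    refine mul_ne_zero ?_ (mul_ne_zero hm hn) h.symm
    exact Nat.cast_ne_zero.2 (Nat.pos_iff_ne_zero.1 (Nat.choose_pos (by omega)))

/-- In characteristic zero an element with nonzero derivative is transcendental over any ring of
constants. -/
theorem Derivation.transcendental_of_ne_zero {A K : Type*} [CommRing A] [Field K] [CharZero K]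
    [Algebra A K] (hinj : Function.Injective (algebraMap A K)) (D : Derivation ℤ K K)
    (hD : ∀ a : A, D (algebraMap A K a) = 0) {x : K} (hx : D x ≠ 0) : Transcendental A x := by
  have hsmul : ∀ (a : A) (y : K), D (a • y) = a • D y := by
    intro a y
    rw [Algebra.smul_def, Derivation.leibniz, hD, smul_zero, add_zero, smul_eq_mul,
      Algebra.smul_def]
  let D' : Derivation A K K := Derivation.mk'
    { toFun := D, map_add' := D.map_add, map_smul' := hsmul } (fun a b => D.leibniz a b)
  have hA : CharZero A := ⟨fun a b h => Nat.cast_injective (R := K) (by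
    simpa using congrArg (algebraMap A K) h)⟩
  have hdom : NoZeroDivisors A := hinj.noZeroDivisors _ (map_zero _) (map_mul _)
  suffices H : ∀ n : ℕ, ∀ p : Polynomial A, p.natDegree ≤ n → Polynomial.aeval x p = 0 → p = 0 by
    rintro ⟨p, hp, h⟩
    exact hp (H _ p le_rfl h)
  intro n
  induction n with
  | zero =>
    intro p hp h
    rw [Polynomial.eq_C_of_natDegree_le_zero hp] at h ⊢
    rw [Polynomial.aeval_C] at h
    rw [hinj (h.trans (map_zero _).symm), map_zero]
  | succ n ih =>
    intro p hp h
    -- Chain rule: applying D to p(x) = 0 gives p'(x) · Dx = 0, so p' is a relation of smaller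
    -- degree.
    have h1 : Polynomial.aeval x (Polynomial.derivative p) * D x = 0 := by
      have := D'.map_aeval p x
      rw [h, map_zero] at this
      exact this.symm
    have h2 := ih (Polynomial.derivative p)
      ((Polynomial.natDegree_derivative_le p).trans (by omega))
      ((mul_eq_zero.1 h1).resolve_right hx)
    rw [Polynomial.eq_C_of_derivative_eq_zero h2] at h ⊢
    rw [Polynomial.aeval_C] at h
    rw [hinj (h.trans (map_zero _).symm), map_zero]

/-- An element of the fraction field of a Noetherian normal domain that is not in the domain has
its ideal of denominators contained in a prime of height one. -/
theorem exists_prime_height_one_of_notMem_range {B K : Type*} [CommRing B] [IsDomain B]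
    [IsNoetherianRing B] [IsIntegrallyClosed B] [Field K] [Algebra B K] [IsFractionRing B K]
    {x : K} (hx : x ∉ (algebraMap B K).range) :
    ∃ p : Ideal B, p.IsPrime ∧ p.height = 1 ∧
      ∀ c : B, algebraMap B K c * x ∈ (algebraMap B K).range → c ∈ p := by
  let J : K → Ideal B := fun y =>
    { carrier := {c | algebraMap B K c * y ∈ (algebraMap B K).range}
      zero_mem' := by simp
      add_mem' := fun {a b} ha hb => by
        simp only [Set.mem_ofPred_eq, map_add, add_mul] at *
        exact add_mem ha hb
      smul_mem' := fun c a ha => by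
        simp only [Set.mem_ofPred_eq, smul_eq_mul, map_mul, mul_assoc] at *
        exact mul_mem ⟨c, rfl⟩ ha }
  have hJ : ∀ y c, c ∈ J y ↔ algebraMap B K c * y ∈ (algebraMap B K).range := fun y c => Iff.rfl
  -- A maximal denominator ideal among the multiples bx not in B is prime, by the usual
  -- associated-prime argument.
  let S : Set (Ideal B) := {I | ∃ b : B, algebraMap B K b * x ∉ (algebraMap B K).range ∧
    I = J (algebraMap B K b * x)}
  have hS : S.Nonempty := ⟨J x, 1, by simpa using hx, by simp⟩
  obtain ⟨P, ⟨b, hb, rfl⟩, hmax⟩ := set_has_maximal_iff_noetherian.2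
    (inferInstance : IsNoetherian B B) S hS
  set y := algebraMap B K b * x with hy
  have hprime : (J y).IsPrime := by
    refine ⟨fun h => hb ?_, fun {c d} hcd => ?_⟩
    · have := (Ideal.eq_top_iff_one _).1 h
      simpa [hJ] using this
    · by_contra! hcon
      obtain ⟨hc, hd⟩ := hcon
      refine hmax (J (algebraMap B K d * y)) ⟨d * b, ?_, ?_⟩ ?_
      · rw [hJ] at hd
        rwa [map_mul, mul_assoc]
      · rw [map_mul, mul_assoc]
      · refine lt_of_le_of_ne (fun a ha => ?_) (fun h => hc ?_)
        · rw [hJ] at ha ⊢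
          rw [mul_left_comm]
          exact mul_mem ⟨d, rfl⟩ ha
        · rw [h, hJ, ← mul_assoc, ← map_mul]
          exact hcd
  have hne : J y ≠ ⊥ := by
    obtain ⟨n, d, hd, h⟩ := IsFractionRing.div_surjective (A := B) y
    refine fun hbot => nonZeroDivisors.ne_zero hd ?_
    rw [← Ideal.mem_bot, ← hbot, hJ, ← h, mul_div_cancel₀]
    · exact ⟨n, rfl⟩
    · exact IsFractionRing.to_map_ne_zero_of_mem_nonZeroDivisors hd
  refine ⟨J y, hprime, le_antisymm ?_ ?_, fun c hc => ?_⟩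
  -- Either multiplication by y keeps J y inside itself, making y integral and hence in B by
  -- normality, or some p in J y has py = u outside J y. In the second case J y is minimal over (p),
  -- so Krull's principal ideal theorem applies.
  · obtain ⟨p, hp, u, hu, hpu⟩ :
        ∃ p ∈ J y, ∃ u, u ∉ J y ∧ algebraMap B K u = algebraMap B K p * y := by
      by_contra! hcon
      refine hb ?_
      let M := Submodule.map (Algebra.linearMap B K) (J y)
      have hint : IsIntegral B y := by
        refine isIntegral_of_smul_mem_submodule M ?_ ?_ y ?_
        · obtain ⟨a, ha, ha0⟩ := (Submodule.ne_bot_iff _).1 hne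
          refine (Submodule.ne_bot_iff _).2 ⟨algebraMap B K a, ⟨a, ha, rfl⟩, ?_⟩
          exact (map_ne_zero_iff _ (IsFractionRing.injective B K)).2 ha0
        · exact (IsNoetherian.noetherian (J y)).map _
        · rintro _ ⟨a, ha, rfl⟩
          obtain ⟨u, hu⟩ := (hJ _ _).1 ha
          refine ⟨u, ?_, ?_⟩
          · by_contra hu'
            exact hcon a ha u hu' hu
          · rw [Algebra.linearMap_apply, hu, smul_eq_mul, mul_comm]; rfl
      obtain ⟨z, hz⟩ := IsIntegrallyClosed.algebraMap_eq_of_integral hint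
      exact ⟨z, hz⟩
    refine Ideal.height_le_one_of_isPrincipal_of_mem_minimalPrimes (Ideal.span {p}) (J y) ?_
    refine ⟨⟨hprime, (Ideal.span_singleton_le_iff_mem _).2 hp⟩, ?_⟩
    rintro Q ⟨hQ, hpQ⟩ hQP c hc
    obtain ⟨v, hv⟩ := (hJ _ _).1 hc
    have h1 : c * u = p * v := IsFractionRing.injective B K (by
      rw [map_mul, map_mul, hv, hpu]; ring)
    refine (hQ.mem_or_mem (show c * u ∈ Q from ?_)).resolve_right (fun h => hu (hQP h))
    rw [h1]
    exact Ideal.mul_mem_right _ _ ((Ideal.span_singleton_le_iff_mem _).1 hpQ)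
  · rw [Order.one_le_iff_ne_zero]
    exact fun h => hne (Ideal.height_eq_zero_iff_eq_bot.1 h)
  · rw [hJ, hy, mul_left_comm]
    exact mul_mem ⟨b, rfl⟩ hc

/-- Being a polynomial ring in one variable can be tested with any coefficient ring. -/
theorem IsPolynomialRingInOneVariable.of_ringEquiv {R A : Type*} [CommRing R] [CommRing A]
    (e : R ≃+* Polynomial A) : IsPolynomialRingInOneVariable R := by
  let g : A →+* R := e.symm.toRingHom.comp Polynomial.C
  have hg : Function.Injective g := e.symm.injective.comp Polynomial.C_injective
  let e' : A ≃+* g.range := RingEquiv.ofBijective g.rangeRestrict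
    ⟨fun a b h => hg (congrArg Subtype.val h), g.rangeRestrict_surjective⟩
  refine ⟨g.range, ⟨AlgEquiv.ofRingEquiv (f := e.trans (Polynomial.mapEquiv e')) ?_⟩⟩
  intro r
  obtain ⟨a, rfl⟩ := e'.surjective r
  have : algebraMap g.range R (e' a) = e.symm (Polynomial.C a) := rfl
  rw [this]
  simp

open DirectSum

/-! ### Homogeneous elements of a ℤ-graded domain. -/

section GradedBasics

variable {B : Type*} [CommRing B] (𝒜 : ℤ → AddSubgroup B) [GradedRing 𝒜]

/-- If a sum of homogeneous elements of pairwise distinct degrees vanishes, so does each term. -/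
theorem GradedRing.eq_zero_of_sum_eq_zero {ι : Type*} {g : ι → ℤ} (hg : Function.Injective g)
    {s : Finset ι} {x : ι → B} (hx : ∀ i ∈ s, x i ∈ 𝒜 (g i)) (h : ∑ i ∈ s, x i = 0) :
    ∀ i ∈ s, x i = 0 := by
  intro i hi
  have h1 : GradedRing.proj 𝒜 (g i) (∑ j ∈ s, x j) = 0 := by rw [h, map_zero]
  rw [map_sum, Finset.sum_eq_single i] at h1
  · rwa [GradedRing.proj_apply, DirectSum.decompose_of_mem_same _ (hx i hi)] at h1
  · intro j hj hji
    rw [GradedRing.proj_apply, DirectSum.decompose_of_mem_ne _ (hx j hj) (hg.ne hji)]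
  · exact fun h => (h hi).elim

theorem GradedRing.degree_eq {x : B} {i j : ℤ} (hi : x ∈ 𝒜 i) (hj : x ∈ 𝒜 j) (hx : x ≠ 0) :
    i = j :=
  DirectSum.degree_eq_of_mem_mem 𝒜 hi hj hx

variable [IsDomain B]

/-- If only one pair of degrees sums to a + b, the component of xy there is a single product of
nonzero elements, so it survives and must sit in degree n. -/
theorem GradedRing.add_eq_of_uniqueAdd {x y : B} {n a b : ℤ} (hxy : x * y ∈ 𝒜 n)
    (ha : (decompose 𝒜 x a : B) ≠ 0) (hb : (decompose 𝒜 y b : B) ≠ 0)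
    (hu : ∀ a' b', (decompose 𝒜 x a' : B) ≠ 0 → (decompose 𝒜 y b' : B) ≠ 0 → a' + b' = a + b →
      a' = a ∧ b' = b) : a + b = n := by
  classical
  by_contra hne
  have h := DirectSum.decompose_of_mem_ne 𝒜 hxy (Ne.symm hne)
  rw [DirectSum.decompose_mul, DirectSum.coe_mul_apply, Finset.sum_eq_single (a, b)] at h
  · exact mul_ne_zero ha hb h
  · rintro ⟨a', b'⟩ h1 h2
    simp only [Finset.mem_filter, Finset.mem_product, DFinsupp.mem_support_iff] at h1
    refine (h2 ?_).elim
    obtain ⟨rfl, rfl⟩ := hu a' b' (by simpa using h1.1.1) (by simpa using h1.1.2) h1.2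
    rfl
  · intro h1
    simp only [Finset.mem_filter, Finset.mem_product, DFinsupp.mem_support_iff] at h1
    refine (h1 ⟨⟨?_, ?_⟩, trivial⟩).elim
    · simpa using ha
    · simpa using hb

/-- A factor of a nonzero homogeneous element of a `ℤ`-graded domain is homogeneous. -/
theorem GradedRing.exists_mem_of_mul_mem {x y : B} {n : ℤ} (hxy : x * y ∈ 𝒜 n)
    (h0 : x * y ≠ 0) : ∃ i, x ∈ 𝒜 i := by
  classical
  have hne : ∀ z : B, z ≠ 0 → (decompose 𝒜 z).support.Nonempty := by
    intro z hz
    rw [Finset.nonempty_iff_ne_empty]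
    intro h
    rw [DFinsupp.support_eq_empty] at h
    exact hz (by simpa using congrArg (decompose 𝒜).symm h)
  have hmem : ∀ (z : B) i, i ∈ (decompose 𝒜 z).support ↔ (decompose 𝒜 z i : B) ≠ 0 := by
    intro z i
    rw [DFinsupp.mem_support_iff, Ne, Ne, ZeroMemClass.coe_eq_zero]
  have hx := hne x (left_ne_zero_of_mul h0)
  have hy := hne y (right_ne_zero_of_mul h0)
  -- The pair of largest degrees and the pair of smallest degrees both have unique sums, so both
  -- sums equal n and the support of x is one point.
  have h1 := GradedRing.add_eq_of_uniqueAdd 𝒜 hxy ((hmem _ _).1 (Finset.max'_mem _ hx))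
    ((hmem _ _).1 (Finset.max'_mem _ hy)) (by
      intro a b ha hb hab
      have := Finset.le_max' _ _ ((hmem _ _).2 ha)
      have := Finset.le_max' _ _ ((hmem _ _).2 hb)
      omega)
  have h2 := GradedRing.add_eq_of_uniqueAdd 𝒜 hxy ((hmem _ _).1 (Finset.min'_mem _ hx))
    ((hmem _ _).1 (Finset.min'_mem _ hy)) (by
      intro a b ha hb hab
      have := Finset.min'_le _ _ ((hmem _ _).2 ha)
      have := Finset.min'_le _ _ ((hmem _ _).2 hb)
      omega)
  have h3 := Finset.min'_le _ _ (Finset.max'_mem _ hx)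
  have h4 := Finset.min'_le _ _ (Finset.max'_mem _ hy)
  obtain ⟨m, hm⟩ : ∃ m, m = (decompose 𝒜 x).support.max' hx := ⟨_, rfl⟩
  refine ⟨m, ?_⟩
  rw [← DirectSum.sum_support_decompose 𝒜 x]
  refine sum_mem fun i hi => ?_
  have h5 := Finset.le_max' _ _ hi
  have h6 := Finset.min'_le _ _ hi
  have : i = m := by omega
  rw [← this]
  exact SetLike.coe_mem _

/-- A field contained in a `ℤ`-graded domain lies in degree zero. -/
theorem GradedRing.algebraMap_mem_zero {k : Type*} [Field k] [Algebra k B] (c : k) :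
    algebraMap k B c ∈ 𝒜 0 := by
  have hone : (1 : B) ∈ 𝒜 0 := SetLike.GradedOne.one_mem
  have hunit : ∀ c : k, c ≠ 0 → ∃ i, algebraMap k B c ∈ 𝒜 i := by
    intro c hc
    have h : algebraMap k B c * algebraMap k B c⁻¹ = 1 := by
      rw [← map_mul, mul_inv_cancel₀ hc, map_one]
    exact GradedRing.exists_mem_of_mul_mem 𝒜 (h ▸ hone) (h ▸ one_ne_zero)
  by_cases hc : c = 0
  · rw [hc, map_zero]; exact zero_mem _
  -- Nonzero scalars are units, hence homogeneous. If c had degree i ≠ 0, the scalar 1 + c would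
  -- have nonzero components in degrees 0 and i.
  by_cases hc1 : 1 + c = 0
  · rw [eq_neg_of_add_eq_zero_right hc1, map_neg, map_one]
    exact neg_mem hone
  obtain ⟨i, hi⟩ := hunit c hc
  obtain ⟨j, hj⟩ := hunit _ hc1
  rw [map_add, map_one] at hj
  by_cases h0 : i = 0
  · exact h0 ▸ hi
  exfalso
  have hcB : algebraMap k B c ≠ 0 := (map_ne_zero_iff _ (algebraMap k B).injective).2 hc
  by_cases hj0 : j = 0
  · subst hj0
    have : algebraMap k B c ∈ 𝒜 0 := by
      have := sub_mem hj hone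
      rwa [add_sub_cancel_left] at this
    exact h0 (GradedRing.degree_eq 𝒜 hi this hcB)
  · have h1 := DirectSum.decompose_of_mem_ne 𝒜 hj hj0
    rw [DirectSum.decompose_add, DirectSum.add_apply, AddMemClass.coe_add,
      DirectSum.decompose_of_mem_same 𝒜 hone, DirectSum.decompose_of_mem_ne 𝒜 hi h0, add_zero] at h1
    exact one_ne_zero h1

end GradedBasics

/-! ### Veronese subrings: grading, integrality, finite generation. -/

section Veronese

variable {B : Type*} [CommRing B] (𝒜 : ℤ → AddSubgroup B) [GradedRing 𝒜]

theorem mem_veroneseSubring_of_mem {d i : ℤ} {x : B} (hx : x ∈ 𝒜 (d * i)) :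
    x ∈ veroneseSubring 𝒜 d :=
  AddSubgroup.mem_iSup_of_mem i hx

theorem mem_veroneseSubring_of_dvd {d i : ℤ} (h : d ∣ i) {x : B} (hx : x ∈ 𝒜 i) :
    x ∈ veroneseSubring 𝒜 d := by
  obtain ⟨j, rfl⟩ := h
  exact mem_veroneseSubring_of_mem 𝒜 hx

theorem veroneseSubring_induction {d : ℤ} {motive : B → Prop} {x : B}
    (hx : x ∈ veroneseSubring 𝒜 d) (zero : motive 0)
    (add : ∀ a b, motive a → motive b → motive (a + b))
    (hom : ∀ i, ∀ a ∈ 𝒜 (d * i), motive a) : motive x := by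
  change x ∈ (⨆ i : ℤ, 𝒜 (d * i)) at hx
  induction hx using AddSubgroup.iSup_induction' with
  | hp i x hx => exact hom i x hx
  | h1 => exact zero
  | hadd x y _ _ hx hy => exact add x y hx hy

/-- The grading of the Veronese subring whose piece of degree `i` is `B_{di}`. -/
def veroneseGrading (d : ℤ) (i : ℤ) : AddSubgroup (veroneseSubring 𝒜 d) :=
  (𝒜 (d * i)).comap (veroneseSubring 𝒜 d).subtype.toAddMonoidHom

theorem mem_veroneseGrading {d i : ℤ} {x : veroneseSubring 𝒜 d} :
    x ∈ veroneseGrading 𝒜 d i ↔ (x : B) ∈ 𝒜 (d * i) := Iff.rfl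

instance (d : ℤ) : SetLike.GradedMonoid (veroneseGrading 𝒜 d) where
  one_mem := by
    rw [mem_veroneseGrading, mul_zero]
    exact SetLike.GradedOne.one_mem
  mul_mem i j x y hx hy := by
    rw [mem_veroneseGrading] at *
    rw [mul_add]
    exact SetLike.GradedMul.mul_mem hx hy

/-- The condition d ≠ 0 keeps the degrees d * i distinct. -/
theorem veroneseGrading_isInternal {d : ℤ} (hd : d ≠ 0) :
    DirectSum.IsInternal (veroneseGrading 𝒜 d) := by
  classical
  constructor
  · rw [injective_iff_map_eq_zero]
    intro x hx
    have h1 : ∑ i ∈ x.support, ((x i : veroneseSubring 𝒜 d) : B) = 0 := by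
      rw [DirectSum.coeAddMonoidHom_eq_dfinsuppSum, DFinsupp.sum] at hx
      rw [← AddSubmonoidClass.coe_finsetSum, hx]; rfl
    have h2 := GradedRing.eq_zero_of_sum_eq_zero 𝒜 (g := fun i => d * i)
      (mul_right_injective₀ hd) (fun i _ => mem_veroneseGrading 𝒜 |>.1 (x i).2) h1
    ext i
    by_cases hi : i ∈ x.support
    · simpa using h2 i hi
    · rw [DFinsupp.notMem_support_iff] at hi
      simp [hi]
  · rintro ⟨x, hx⟩
    have : ∀ (x : B), x ∈ veroneseSubring 𝒜 d → ∃ y : ⨁ i, veroneseGrading 𝒜 d i,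
        ((DirectSum.coeAddMonoidHom (veroneseGrading 𝒜 d) y : veroneseSubring 𝒜 d) : B) = x := by
      intro x hx
      refine veroneseSubring_induction 𝒜 (motive := fun x => ∃ y : ⨁ i, veroneseGrading 𝒜 d i,
        ((DirectSum.coeAddMonoidHom (veroneseGrading 𝒜 d) y : veroneseSubring 𝒜 d) : B) = x)
        hx ⟨0, by simp⟩ ?_ ?_
      · rintro a b ⟨y, rfl⟩ ⟨z, rfl⟩
        exact ⟨y + z, by simp⟩
      · intro i a ha
        exact ⟨DirectSum.of (fun i => veroneseGrading 𝒜 d i) i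
          ⟨⟨a, mem_veroneseSubring_of_mem 𝒜 ha⟩, ha⟩, by simp⟩
    obtain ⟨y, hy⟩ := this x hx
    exact ⟨y, Subtype.ext hy⟩

/-- The grading of the Veronese subring, as a graded ring structure. -/
noncomputable abbrev veroneseGradedRing {d : ℤ} (hd : d ≠ 0) :
    GradedRing (veroneseGrading 𝒜 d) :=
  { (inferInstance : SetLike.GradedMonoid (veroneseGrading 𝒜 d)),
    (veroneseGrading_isInternal 𝒜 hd).chooseDecomposition with }

theorem pow_mem_veroneseSubring {d : ℕ} {i : ℤ} {x : B} (hx : x ∈ 𝒜 i) :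
    x ^ d ∈ veroneseSubring 𝒜 d := by
  refine mem_veroneseSubring_of_mem 𝒜 (i := i) ?_
  have := SetLike.pow_mem_graded d hx
  rwa [nsmul_eq_mul] at this

/-- The d-th power of a homogeneous element has degree divisible by d. -/
theorem veroneseSubring_isIntegral {d : ℕ} (hd : 1 ≤ d) :
    Algebra.IsIntegral (veroneseSubring 𝒜 d) B := by
  classical
  refine ⟨fun b => ?_⟩
  rw [← DirectSum.sum_support_decompose 𝒜 b]
  refine IsIntegral.sum _ fun i _ => ?_
  refine IsIntegral.of_pow hd ?_
  exact isIntegral_algebraMap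
    (x := (⟨_, pow_mem_veroneseSubring 𝒜 (SetLike.coe_mem (decompose 𝒜 b i))⟩ :
      veroneseSubring 𝒜 d))

variable [IsDomain B]

/-- The ground field maps into every Veronese subring. -/
noncomputable abbrev veroneseAlgebra (k : Type*) [Field k] [Algebra k B] (d : ℤ) :
    Algebra k (veroneseSubring 𝒜 d) :=
  ((algebraMap k B).codRestrict (veroneseSubring 𝒜 d) fun c =>
    mem_veroneseSubring_of_mem 𝒜 (i := 0) (by
      rw [mul_zero]; exact GradedRing.algebraMap_mem_zero 𝒜 c)).toAlgebra

/-- Artin–Tate: B is integral and of finite type, hence finite, over the Veronese subring. -/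
theorem veroneseSubring_finiteType (k : Type*) [Field k] [Algebra k B] [Algebra.FiniteType k B]
    {d : ℕ} (hd : 1 ≤ d) :
    letI := veroneseAlgebra 𝒜 k d
    Algebra.FiniteType k (veroneseSubring 𝒜 d) := by
  let _ := veroneseAlgebra 𝒜 k d
  have : IsScalarTower k (veroneseSubring 𝒜 d) B := IsScalarTower.of_algebraMap_eq fun _ => rfl
  have := veroneseSubring_isIntegral 𝒜 hd
  have : Algebra.FiniteType (veroneseSubring 𝒜 d) B := .of_restrictScalars_finiteType k _ _
  have : Module.Finite (veroneseSubring 𝒜 d) B := Algebra.IsIntegral.finite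
  exact ⟨fg_of_fg_of_fg k (veroneseSubring 𝒜 d) B Algebra.FiniteType.out Module.Finite.fg_top
    Subtype.val_injective⟩

end Veronese

/-! ### Homogeneous components of derivations. -/

section Homogenization

variable {R : Type*} [CommRing R]

theorem Derivation.iterate_eq_zero_of_le (D : Derivation ℤ R R) {m n : ℕ} (hmn : m ≤ n) {x : R}
    (h : D^[m] x = 0) : D^[n] x = 0 := by
  obtain ⟨l, rfl⟩ := Nat.exists_eq_add_of_le' hmn
  rw [Function.iterate_add_apply, h, iterate_map_zero]

variable (ℛ : ℤ → AddSubgroup R) [GradedRing ℛ]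

/-- Local nilpotency can be tested on homogeneous elements. -/
theorem isLocallyNilpotentDerivation_of_homogeneous (D : Derivation ℤ R R)
    (h : ∀ i, ∀ x ∈ ℛ i, ∃ n : ℕ, D^[n] x = 0) : IsLocallyNilpotentDerivation D := by
  intro x
  suffices H : ∃ n : ℕ, D^[n] x = 0 by
    obtain ⟨n, hn⟩ := H
    exact ⟨n + 1, by omega, D.iterate_eq_zero_of_le (by omega) hn⟩
  induction x using DirectSum.Decomposition.inductionOn ℛ with
  | zero => exact ⟨0, rfl⟩
  | homogeneous x => exact h _ _ x.2
  | add x y hx hy =>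
    obtain ⟨m, hm⟩ := hx
    obtain ⟨n, hn⟩ := hy
    refine ⟨max m n, ?_⟩
    rw [iterate_map_add, D.iterate_eq_zero_of_le (le_max_left m n) hm,
      D.iterate_eq_zero_of_le (le_max_right m n) hn, add_zero]

/-- The component of degree `e` of an additive endomorphism of a graded ring. -/
def homogeneousComponentHom (D : R →+ R) (e : ℤ) : R →+ R :=
  (DirectSum.toAddMonoid fun i =>
    (GradedRing.proj ℛ (i + e)).comp (D.comp (ℛ i).subtype)).comp
    (decomposeAddEquiv ℛ).toAddMonoidHom

theorem homogeneousComponentHom_apply (D : R →+ R) (e : ℤ) {i : ℤ} {x : R} (hx : x ∈ ℛ i) :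
    homogeneousComponentHom ℛ D e x = GradedRing.proj ℛ (i + e) (D x) := by
  simp [homogeneousComponentHom, DirectSum.decompose_of_mem ℛ hx]

theorem homogeneousComponentHom_leibniz (D : Derivation ℤ R R) (e : ℤ) (x y : R) :
    homogeneousComponentHom ℛ (D : R →+ R) e (x * y) =
      x • homogeneousComponentHom ℛ (D : R →+ R) e y +
        y • homogeneousComponentHom ℛ (D : R →+ R) e x := by
  induction x using DirectSum.Decomposition.inductionOn ℛ with
  | zero => simp
  | add a b ha hb => rw [add_mul, map_add, ha, hb, map_add]; simp only [smul_eq_mul]; ring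
  | @homogeneous i a =>
    induction y using DirectSum.Decomposition.inductionOn ℛ with
    | zero => simp
    | add b c hb hc => rw [mul_add, map_add, hb, hc, map_add]; simp only [smul_eq_mul]; ring
    | @homogeneous j b =>
      rw [homogeneousComponentHom_apply ℛ _ e (SetLike.GradedMul.mul_mem a.2 b.2),
        homogeneousComponentHom_apply ℛ _ e a.2, homogeneousComponentHom_apply ℛ _ e b.2]
      simp only [AddMonoidHom.coe_coe, Derivation.leibniz, map_add, smul_eq_mul,
        GradedRing.proj_apply]
      congr 1
      · rw [add_assoc, DirectSum.coe_decompose_mul_add_of_left_mem ℛ a.2]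
      · rw [add_comm i j, add_assoc, DirectSum.coe_decompose_mul_add_of_left_mem ℛ b.2]

/-- The component of degree `e` of a derivation of a graded ring. -/
def Derivation.homogeneousComponent (D : Derivation ℤ R R) (e : ℤ) : Derivation ℤ R R :=
  Derivation.mk' (homogeneousComponentHom ℛ (D : R →+ R) e).toIntLinearMap
    (homogeneousComponentHom_leibniz ℛ D e)

variable (D : Derivation ℤ R R)

theorem Derivation.homogeneousComponent_apply (e : ℤ) {i : ℤ} {x : R} (hx : x ∈ ℛ i) :
    D.homogeneousComponent ℛ e x = decompose ℛ (D x) (i + e) :=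
  homogeneousComponentHom_apply ℛ (D : R →+ R) e hx

theorem Derivation.homogeneousComponent_mem (e : ℤ) {i : ℤ} {x : R} (hx : x ∈ ℛ i) :
    D.homogeneousComponent ℛ e x ∈ ℛ (i + e) := by
  rw [D.homogeneousComponent_apply ℛ e hx]
  exact SetLike.coe_mem _

/-- The value of D at a homogeneous element has only finitely many components. The bound depends on
x; finite generation later makes it uniform. -/
theorem Derivation.exists_homogeneousComponent_eq_zero (x : R) :
    ∃ E : ℤ, ∀ e, E < e → D.homogeneousComponent ℛ e x = 0 := by
  classical
  induction x using DirectSum.Decomposition.inductionOn ℛ with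
  | zero => exact ⟨0, by simp⟩
  | add a b ha hb =>
    obtain ⟨E, hE⟩ := ha
    obtain ⟨F, hF⟩ := hb
    exact ⟨max E F, fun e he => by
      rw [map_add, hE e ((le_max_left _ _).trans_lt he), hF e ((le_max_right _ _).trans_lt he),
        add_zero]⟩
  | @homogeneous i a =>
    obtain ⟨M, hM⟩ := (decompose ℛ (D a)).support.bddAbove
    refine ⟨M - i, fun e he => ?_⟩
    rw [D.homogeneousComponent_apply ℛ e a.2]
    by_contra h
    have : i + e ∈ (decompose ℛ (D a)).support := by
      rw [DFinsupp.mem_support_iff]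
      exact fun h0 => h (by rw [h0]; rfl)
    have := hM this
    omega

theorem Derivation.decompose_apply_eq_sum [∀ i (x : ℛ i), Decidable (x ≠ 0)] (j : ℤ) (y : R) :
    (decompose ℛ (D y) j : R) =
      ∑ l ∈ (decompose ℛ y).support, D.homogeneousComponent ℛ (j - l) (decompose ℛ y l) := by
  conv_lhs => rw [← DirectSum.sum_support_decompose ℛ y]
  rw [map_sum, ← GradedRing.proj_apply, map_sum]
  refine Finset.sum_congr rfl fun l _ => ?_
  rw [D.homogeneousComponent_apply ℛ _ (SetLike.coe_mem _), add_sub_cancel, GradedRing.proj_apply]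

/-- The iterates of the top component of a derivation are the top components of its iterates. -/
theorem Derivation.iterate_homogeneousComponent {E : ℤ}
    (hE : ∀ e, E < e → D.homogeneousComponent ℛ e = 0) {i : ℤ} {x : R} (hx : x ∈ ℛ i) (n : ℕ) :
    (∀ j, i + n * E < j → (decompose ℛ (D^[n] x) j : R) = 0) ∧
      (decompose ℛ (D^[n] x) (i + n * E) : R) = (D.homogeneousComponent ℛ E)^[n] x := by
  classical
  induction n with
  | zero =>
    refine ⟨fun j hj => ?_, ?_⟩
    · exact DirectSum.decompose_of_mem_ne ℛ hx (by simp at hj; omega)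
    · rw [show i + ((0 : ℕ) : ℤ) * E = i by simp]
      exact DirectSum.decompose_of_mem_same ℛ hx
  | succ n ih =>
    obtain ⟨ih1, ih2⟩ := ih
    have hle : ∀ l ∈ (decompose ℛ (D^[n] x)).support, l ≤ i + n * E := by
      intro l hl
      by_contra! h
      rw [DFinsupp.mem_support_iff] at hl
      exact hl (Subtype.ext (ih1 l h))
    rw [Function.iterate_succ_apply', Function.iterate_succ_apply']
    push_cast
    refine ⟨fun j hj => ?_, ?_⟩
    · rw [D.decompose_apply_eq_sum ℛ]
      refine Finset.sum_eq_zero fun l hl => ?_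
      rw [hE _ (by have := hle l hl; linarith), Derivation.coe_zero, Pi.zero_apply]
    -- A component of the n-th iterate in degree l < i + nE would have to be raised by more than E
    -- to contribute here.
    · rw [D.decompose_apply_eq_sum ℛ, Finset.sum_eq_single (i + n * E)]
      · rw [ih2]
        congr 2
        ring
      · intro l hl hne
        have := lt_of_le_of_ne (hle l hl) hne
        rw [hE _ (by linarith), Derivation.coe_zero, Pi.zero_apply]
      · intro h
        rw [DFinsupp.notMem_support_iff] at h
        rw [h, ZeroMemClass.coe_zero, map_zero]

/-- A nonzero locally nilpotent derivation of a finitely generated graded domain can be replaced by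
a homogeneous one. -/
theorem IsLocallyNilpotentDerivation.exists_homogeneous {k : Type*} [Field k] [CharZero k]
    [IsDomain R] [Algebra k R] [Algebra.FiniteType k R] {D : Derivation ℤ R R}
    (hD : IsLocallyNilpotentDerivation D) (h0 : D ≠ 0) :
    ∃ (e : ℤ) (D' : Derivation ℤ R R), D' ≠ 0 ∧ IsLocallyNilpotentDerivation D' ∧
      ∀ i, ∀ x ∈ ℛ i, D' x ∈ ℛ (i + e) := by
  classical
  have : CharZero R := charZero_of_injective_algebraMap (algebraMap k R).injective
  -- Derivations are only assumed ℤ-linear; local nilpotency makes them vanish on scalars, which are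
  -- zero or units. This lets the degree bound be checked on algebra generators.
  have hk : ∀ c : k, D (algebraMap k R c) = 0 := by
    intro c
    by_cases hc : c = 0
    · rw [hc, map_zero, map_zero]
    · exact hD.apply_eq_zero_of_mul_eq_one (v := algebraMap k R c⁻¹) (by
        rw [← map_mul, mul_inv_cancel₀ hc, map_one])
  obtain ⟨S, hS⟩ := (Algebra.FiniteType.out : (⊤ : Subalgebra k R).FG)
  obtain ⟨M, hM⟩ : ∃ M : ℤ, ∀ e, M < e → ∀ s ∈ S, D.homogeneousComponent ℛ e s = 0 := by
    clear hS
    induction S using Finset.induction with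
    | empty => exact ⟨0, by simp⟩
    | insert s S _ ih =>
      obtain ⟨M, hM⟩ := ih
      obtain ⟨E, hE⟩ := D.exists_homogeneousComponent_eq_zero ℛ s
      refine ⟨max M E, fun e he t ht => ?_⟩
      rcases Finset.mem_insert.1 ht with rfl | ht
      · exact hE e ((le_max_right _ _).trans_lt he)
      · exact hM e ((le_max_left _ _).trans_lt he) t ht
  have hM' : ∀ e, M < e → D.homogeneousComponent ℛ e = 0 := by
    intro e he
    ext x
    rw [Derivation.coe_zero, Pi.zero_apply]
    have hx : x ∈ Algebra.adjoin k (S : Set R) := hS ▸ Algebra.mem_top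
    induction hx using Algebra.adjoin_induction with
    | mem x hx => exact hM e he x hx
    | algebraMap c =>
      rw [D.homogeneousComponent_apply ℛ e (GradedRing.algebraMap_mem_zero ℛ c), hk]
      simp
    | add x y _ _ hx hy => rw [map_add, hx, hy, add_zero]
    | mul x y _ _ hx hy => rw [Derivation.leibniz, hx, hy, smul_zero, smul_zero, add_zero]
  obtain ⟨E, hE, hmax⟩ : ∃ E, D.homogeneousComponent ℛ E ≠ 0 ∧
      ∀ z, D.homogeneousComponent ℛ z ≠ 0 → z ≤ E := by
    refine Int.exists_greatest_of_bdd ⟨M, fun z hz => ?_⟩ ?_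
    · by_contra! h
      exact hz (hM' z h)
    · by_contra! h
      refine h0 (Derivation.ext fun x => ?_)
      rw [← DirectSum.sum_support_decompose ℛ (D x)]
      refine Finset.sum_eq_zero fun j _ => ?_
      rw [D.decompose_apply_eq_sum ℛ]
      exact Finset.sum_eq_zero fun l _ => by rw [h, Derivation.coe_zero, Pi.zero_apply]
  refine ⟨E, D.homogeneousComponent ℛ E, hE, ?_, fun i x hx => D.homogeneousComponent_mem ℛ E hx⟩
  refine isLocallyNilpotentDerivation_of_homogeneous ℛ _ fun i x hx => ?_
  obtain ⟨n, _, hn⟩ := hD x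
  refine ⟨n, ?_⟩
  rw [← (D.iterate_homogeneousComponent ℛ (E := E) (fun e he => ?_) hx n).2, hn]
  · simp
  · by_contra h
    exact absurd (hmax e h) (not_le.2 he)

end Homogenization

/-! ### Graded pieces of B[1/f] inside the fraction field. -/

section FractionPieces

variable {B : Type*} [CommRing B] {𝒜 : ℤ → AddSubgroup B} [SetLike.GradedMonoid 𝒜]
  {K : Type*} [Field K] [Algebra B K]

local notation "ι" => algebraMap B K

variable (K) in
/-- The elements `b / f ^ l` of the fraction field that have degree `i`, for `f` homogeneous of
degree `n`. -/
def fracPiece {f : B} {n : ℤ} (hf : f ∈ 𝒜 n) (i : ℤ) : AddSubgroup K where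
  carrier := {x | ∃ l : ℕ, ∃ b ∈ 𝒜 (i + l * n), x * ι f ^ l = ι b}
  zero_mem' := ⟨0, 0, zero_mem _, by simp⟩
  add_mem' := by
    rintro x y ⟨l, b, hb, hx⟩ ⟨m, c, hc, hy⟩
    refine ⟨l + m, b * f ^ m + c * f ^ l, add_mem ?_ ?_, ?_⟩
    · have := SetLike.GradedMul.mul_mem hb (SetLike.pow_mem_graded m hf)
      convert this using 2
      push_cast [nsmul_eq_mul]; ring
    · have := SetLike.GradedMul.mul_mem hc (SetLike.pow_mem_graded l hf)
      convert this using 2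
      push_cast [nsmul_eq_mul]; ring
    · rw [map_add, map_mul, map_mul, ← hx, ← hy, map_pow, map_pow]
      ring
  neg_mem' := by
    rintro x ⟨l, b, hb, hx⟩
    exact ⟨l, -b, neg_mem hb, by rw [map_neg, ← hx, neg_mul]⟩

variable {f : B} {n : ℤ} (hf : f ∈ 𝒜 n)

theorem mem_fracPiece {i : ℤ} {x : K} :
    x ∈ fracPiece K hf i ↔ ∃ l : ℕ, ∃ b ∈ 𝒜 (i + l * n), x * ι f ^ l = ι b := Iff.rfl

theorem algebraMap_mem_fracPiece {i : ℤ} {b : B} (hb : b ∈ 𝒜 i) : ι b ∈ fracPiece K hf i :=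
  ⟨0, b, by simpa using hb, by simp⟩

theorem one_mem_fracPiece : (1 : K) ∈ fracPiece K hf 0 := by
  rw [← map_one ι]
  exact algebraMap_mem_fracPiece hf SetLike.GradedOne.one_mem

theorem mul_mem_fracPiece {i j : ℤ} {x y : K} (hx : x ∈ fracPiece K hf i)
    (hy : y ∈ fracPiece K hf j) : x * y ∈ fracPiece K hf (i + j) := by
  obtain ⟨l, b, hb, hx⟩ := hx
  obtain ⟨m, c, hc, hy⟩ := hy
  refine ⟨l + m, b * c, ?_, ?_⟩
  · have := SetLike.GradedMul.mul_mem hb hc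
    convert this using 2
    push_cast; ring
  · rw [map_mul, ← hx, ← hy]; ring

theorem pow_mem_fracPiece {i : ℤ} {x : K} (hx : x ∈ fracPiece K hf i) (m : ℕ) :
    x ^ m ∈ fracPiece K hf (m * i) := by
  induction m with
  | zero => simpa using one_mem_fracPiece hf
  | succ m ih =>
    have := mul_mem_fracPiece hf ih hx
    rw [pow_succ]
    convert this using 2
    push_cast; ring

/-- If `f` divides `h` with homogeneous quotient, then `B[1/f] ⊆ B[1/h]` as graded rings. -/
theorem fracPiece_le_of_mul_eq {g h : B} {m q : ℤ} (hg : g ∈ 𝒜 m) (hh : h ∈ 𝒜 q)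
    (hq : n + m = q) (hfg : f * g = h) (i : ℤ) : fracPiece K hf i ≤ fracPiece K hh i := by
  rintro x ⟨l, b, hb, hx⟩
  refine ⟨l, b * g ^ l, ?_, ?_⟩
  · have := SetLike.GradedMul.mul_mem hb (SetLike.pow_mem_graded l hg)
    convert this using 2
    rw [nsmul_eq_mul, ← hq]; ring
  · rw [map_mul, map_pow, ← hx, ← hfg, map_mul]; ring

variable (K) in
/-- The degree-zero subring of `B[1/f]`, inside the fraction field. -/
def fracSubring : Subring K where
  carrier := fracPiece K hf 0
  zero_mem' := zero_mem _
  one_mem' := one_mem_fracPiece hf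
  add_mem' := add_mem
  neg_mem' := neg_mem
  mul_mem' hx hy := by
    have := mul_mem_fracPiece hf hx hy
    rwa [add_zero] at this

theorem mem_fracSubring {x : K} : x ∈ fracSubring K hf ↔ x ∈ fracPiece K hf 0 := Iff.rfl

variable [IsFractionRing B K]

/-- Nonzero elements stay nonzero in the fraction ring. -/
theorem algebraMap_fractionRing_ne_zero {b : B} (hb : b ≠ 0) : ι b ≠ 0 :=
  (map_ne_zero_iff _ (IsFractionRing.injective B K)).2 hb

/-- A factor h of f becomes invertible, with inverse g/f. -/
theorem inv_mem_fracPiece_of_mul_eq (hf0 : f ≠ 0) {g h : B} {m j : ℤ} (hg : g ∈ 𝒜 m)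
    (hq : j + m = n) (hgh : h * g = f) : (ι h)⁻¹ ∈ fracPiece K hf (-j) := by
  have hh0 : ι h ≠ 0 := algebraMap_fractionRing_ne_zero (left_ne_zero_of_mul (hgh ▸ hf0))
  refine ⟨1, g, ?_, ?_⟩
  · convert hg using 2
    rw [← hq]; push_cast; ring
  · rw [pow_one, ← hgh, map_mul, inv_mul_cancel_left₀ hh0]

theorem zpow_mem_fracPiece (hf0 : f ≠ 0) (j : ℤ) : ι f ^ j ∈ fracPiece K hf (j * n) := by
  obtain ⟨m, rfl | rfl⟩ := j.eq_nat_or_neg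
  · rw [zpow_natCast]
    exact pow_mem_fracPiece hf (algebraMap_mem_fracPiece hf hf) m
  · rw [zpow_neg, zpow_natCast, ← inv_pow]
    have := pow_mem_fracPiece hf (inv_mem_fracPiece_of_mul_eq (K := K) hf hf0 (g := 1) (m := 0)
      SetLike.GradedOne.one_mem (add_zero n) (mul_one f)) m
    convert this using 2
    ring

end FractionPieces

/-! ### Homogeneous localization as a subring of the fraction field. -/

section Away

variable {B : Type*} [CommRing B] [IsDomain B] {𝒜 : ℤ → AddSubgroup B} [GradedRing 𝒜]
  (K : Type*) [Field K] [Algebra B K] [IsFractionRing B K] {f : B} {n : ℤ} (hf : f ∈ 𝒜 n)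

/-- The degree-zero part of `B[1/f]` as a homogeneous localization and as a subring of the
fraction field. -/
theorem nonempty_away_ringEquiv_fracSubring (hf0 : f ≠ 0) :
    Nonempty (HomogeneousLocalization.Away 𝒜 f ≃+* fracSubring K hf) := by
  have hM : Submonoid.powers f ≤ nonZeroDivisors B :=
    powers_le_nonZeroDivisors_of_noZeroDivisors hf0
  have hf0' : algebraMap B K f ≠ 0 := algebraMap_fractionRing_ne_zero hf0
  let g : Localization.Away f →+* K :=
    IsLocalization.lift (M := Submonoid.powers f) (g := algebraMap B K)
      (fun y => IsLocalization.map_units K (⟨y, hM y.2⟩ : nonZeroDivisors B))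
  have hg : Function.Injective g := by
    refine (IsLocalization.lift_injective_iff _).2 fun x y => ?_
    rw [(IsLocalization.injective (Localization.Away f) hM).eq_iff,
      (IsFractionRing.injective B K).eq_iff]
  let φ : HomogeneousLocalization.Away 𝒜 f →+* K :=
    g.comp (algebraMap (HomogeneousLocalization.Away 𝒜 f) (Localization.Away f))
  have hφ : Function.Injective φ :=
    hg.comp (HomogeneousLocalization.val_injective (𝒜 := 𝒜) (Submonoid.powers f))
  have hmk : ∀ (l : ℕ) (b : B) (hb : b ∈ 𝒜 (l • n)),
      φ (HomogeneousLocalization.Away.mk 𝒜 hf l b hb) * algebraMap _ _ f ^ l =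
        algebraMap _ _ b := by
    intro l b hb
    rw [RingHom.comp_apply, HomogeneousLocalization.algebraMap_apply,
      HomogeneousLocalization.Away.val_mk, Localization.mk_eq_mk', ← map_pow]
    exact (mul_comm _ _).trans
      ((IsLocalization.lift_mk'_spec _ _ _ (⟨f ^ l, l, rfl⟩ : Submonoid.powers f)).1 rfl).symm
  refine ⟨RingEquiv.ofBijective (φ.codRestrict (fracSubring K hf) fun x => ?_) ⟨?_, ?_⟩⟩
  · obtain ⟨l, b, hb, rfl⟩ := HomogeneousLocalization.Away.mk_surjective 𝒜 hf x
    exact ⟨l, b, by simpa using hb, hmk l b hb⟩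
  · exact fun x y h => hφ (congrArg Subtype.val h)
  · rintro ⟨x, l, b, hb, hx⟩
    have hb' : b ∈ 𝒜 (l • n) := by simpa using hb
    refine ⟨HomogeneousLocalization.Away.mk 𝒜 hf l b hb', Subtype.ext ?_⟩
    refine mul_right_cancel₀ (pow_ne_zero l hf0') ?_
    exact (hmk l b hb').trans hx.symm

theorem isPolynomialRingInOneVariable_away_iff (hf0 : f ≠ 0) :
    IsPolynomialRingInOneVariable (HomogeneousLocalization.Away 𝒜 f) ↔
      IsPolynomialRingInOneVariable (fracSubring K hf) := by
  obtain ⟨e⟩ := nonempty_away_ringEquiv_fracSubring K hf hf0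
  constructor
  · rintro ⟨A, ⟨h⟩⟩
    exact .of_ringEquiv (e.symm.trans h.toRingEquiv)
  · rintro ⟨A, ⟨h⟩⟩
    exact .of_ringEquiv (e.trans h.toRingEquiv)

end Away

/-! ### From a homogeneous locally nilpotent derivation to a cylinder. -/

section HomogeneousDerivation

variable {B : Type*} [CommRing B] {𝒜 : ℤ → AddSubgroup B} {K : Type*} [Field K] [Algebra B K]

local notation "ι" => algebraMap B K

/-- A derivation of the fraction field that restricts to a homogeneous locally nilpotent derivation
of degree `e` on the homogeneous elements of `B` for the family `𝒜`. -/
structure IsHomogeneousLND (𝒜 : ℤ → AddSubgroup B) (δ : Derivation ℤ K K) (e : ℤ) :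
    Prop where
  map_mem : ∀ i, ∀ b ∈ 𝒜 i, ∃ c ∈ 𝒜 (i + e), δ (ι b) = ι c
  nilpotent : ∀ i, ∀ b ∈ 𝒜 i, ∃ n : ℕ, δ^[n] (ι b) = 0

variable {δ : Derivation ℤ K K} {e : ℤ}

theorem Derivation.apply_mul_of_left_eq_zero {K : Type*} [CommRing K] (δ : Derivation ℤ K K)
    {x : K} (hx : δ x = 0) (y : K) : δ (x * y) = x * δ y := by
  rw [Derivation.leibniz, hx, smul_zero, add_zero, smul_eq_mul]

theorem Derivation.apply_pow_of_eq_zero {K : Type*} [CommRing K] (δ : Derivation ℤ K K)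
    {x : K} (hx : δ x = 0) (m : ℕ) : δ (x ^ m) = 0 := by
  rw [Derivation.leibniz_pow, hx, smul_zero, smul_zero]

theorem Derivation.apply_inv_of_eq_zero {K : Type*} [Field K] (δ : Derivation ℤ K K)
    {x : K} (hx : δ x = 0) : δ x⁻¹ = 0 := by
  rw [Derivation.leibniz_inv, hx, smul_zero]

/-- The subring of constants of a derivation. -/
def Derivation.constants {K : Type*} [CommRing K] (δ : Derivation ℤ K K) : Subring K where
  carrier := {x | δ x = 0}
  zero_mem' := map_zero δ
  one_mem' := δ.map_one_eq_zero
  add_mem' {x y} (hx : δ x = 0) (hy : δ y = 0) := by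
    rw [Set.mem_ofPred_eq, map_add, hx, hy, add_zero]
  neg_mem' {x} (hx : δ x = 0) := by rw [Set.mem_ofPred_eq, map_neg, hx, neg_zero]
  mul_mem' {x y} (hx : δ x = 0) (hy : δ y = 0) := by
    rw [Set.mem_ofPred_eq, δ.apply_mul_of_left_eq_zero hx, hy, mul_zero]

theorem IsHomogeneousLND.iterate_mem (h : IsHomogeneousLND 𝒜 δ e) {i : ℤ} {b : B} (hb : b ∈ 𝒜 i)
    (n : ℕ) : ∃ c ∈ 𝒜 (i + n * e), δ^[n] (ι b) = ι c := by
  induction n with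
  | zero => exact ⟨b, by simpa using hb, rfl⟩
  | succ n ih =>
    obtain ⟨c, hc, h1⟩ := ih
    obtain ⟨c', hc', h2⟩ := h.map_mem _ c hc
    refine ⟨c', ?_, ?_⟩
    · convert hc' using 2
      push_cast; ring
    · rw [Function.iterate_succ_apply', h1, h2]

/-- A nonzero homogeneous locally nilpotent derivation has a homogeneous local slice. -/
theorem IsHomogeneousLND.exists_localSlice (h : IsHomogeneousLND 𝒜 δ e) {i : ℤ} {b : B}
    (hb : b ∈ 𝒜 i) (hne : δ (ι b) ≠ 0) :
    ∃ τ, ∃ t ∈ 𝒜 τ, ∃ a ∈ 𝒜 (τ + e), a ≠ 0 ∧ δ (ι t) = ι a ∧ δ (ι a) = 0 := by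
  classical
  have hex : ∃ n, δ^[n] (ι b) = 0 := h.nilpotent i b hb
  -- The first vanishing iterate has index at least 2 because δb ≠ 0. The slice is δ^m b, and its
  -- derivative is the last nonzero iterate.
  obtain ⟨m, hm⟩ : ∃ m, Nat.find hex = m + 2 := by
    refine Nat.exists_eq_add_of_le' ?_
    by_contra! hlt
    have hs := Nat.find_spec hex
    interval_cases hn : Nat.find hex
    · exact hne (by rw [show ι b = 0 from hs, map_zero])
    · exact hne hs
  have hs := Nat.find_spec hex
  have hs' := Nat.find_min hex (m := m + 1) (by omega)
  rw [hm] at hs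
  obtain ⟨t, ht, h1⟩ := h.iterate_mem hb m
  obtain ⟨a, ha, h2⟩ := h.map_mem _ t ht
  rw [Function.iterate_succ_apply', Function.iterate_succ_apply', h1, h2] at hs
  rw [Function.iterate_succ_apply', h1, h2] at hs'
  refine ⟨_, t, ht, a, ha, ?_, h2, hs⟩
  rintro rfl
  exact hs' (map_zero _)

variable [SetLike.GradedMonoid 𝒜] {a : B} {n : ℤ} (ha : a ∈ 𝒜 n)

theorem IsHomogeneousLND.map_mem_fracPiece (h : IsHomogeneousLND 𝒜 δ e)
    (hδa : δ (ι a) = 0) {i : ℤ} {x : K} (hx : x ∈ fracPiece K ha i) :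
    δ x ∈ fracPiece K ha (i + e) := by
  obtain ⟨l, b, hb, hx⟩ := hx
  obtain ⟨c, hc, h1⟩ := h.map_mem _ b hb
  refine ⟨l, c, ?_, ?_⟩
  · convert hc using 2
    ring
  · rw [← h1, ← hx, mul_comm, mul_comm x,
      δ.apply_mul_of_left_eq_zero (δ.apply_pow_of_eq_zero hδa l)]

/-- In the presence of a slice `s` every homogeneous element on which the derivation is nilpotent
is a polynomial in `s` with homogeneous constant coefficients. -/
theorem IsHomogeneousLND.exists_eq_sum (h : IsHomogeneousLND 𝒜 δ e) [CharZero K]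
    (hdiv : ∀ (m : ℕ) (i : ℤ), ∀ b ∈ 𝒜 i, ∃ c ∈ 𝒜 i, ι b / ((m : K) + 1) = ι c)
    (hδa : δ (ι a) = 0) {s : K} (hs : s ∈ fracPiece K ha (-e))
    (hδs : δ s = 1) (N : ℕ) : ∀ (i : ℤ) (x : K), x ∈ fracPiece K ha i →
      δ^[N] x = 0 → ∃ c : ℕ → K,
        (∀ j : ℕ, c j ∈ fracPiece K ha (i + j * e) ∧ δ (c j) = 0) ∧
          x = ∑ j ∈ Finset.range N, c j * s ^ j := by
  induction N with
  | zero =>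
    intro i x _ hx0
    exact ⟨fun _ => 0, fun j => ⟨zero_mem _, map_zero δ⟩, by simpa using hx0⟩
  | succ N ih =>
    intro i x hx hx0
    obtain ⟨c, hc, h1⟩ := ih (i + e) (δ x) (h.map_mem_fracPiece ha hδa hx) hx0
    have hdivmem : ∀ (m : ℕ) (l : ℤ), ∀ y ∈ fracPiece K ha l,
        y / ((m : K) + 1) ∈ fracPiece K ha l := by
      rintro m l y ⟨q, b, hb, hy⟩
      obtain ⟨b', hb', h2⟩ := hdiv m _ b hb
      exact ⟨q, b', hb', by rw [← h2, ← hy]; ring⟩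
    have hδdiv : ∀ m : ℕ, δ ((m : K) + 1)⁻¹ = 0 := fun m =>
      δ.apply_inv_of_eq_zero (by rw [map_add, δ.map_natCast, δ.map_one_eq_zero, add_zero])
    have hc' : ∀ j, c j / ((j : K) + 1) ∈ fracPiece K ha (i + (j + 1 : ℕ) * e) ∧
        δ (c j / ((j : K) + 1)) = 0 := by
      intro j
      constructor
      · have := hdivmem j _ _ (hc j).1
        convert this using 2
        push_cast; ring
      · rw [div_eq_mul_inv, δ.apply_mul_of_left_eq_zero (hc j).2, hδdiv, mul_zero]
    -- The expansion of δx is integrated term by term in s. The difference r is a constant and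
    -- serves as the coefficient of s^0.
    let r := x - ∑ j ∈ Finset.range N, c j / ((j : K) + 1) * s ^ (j + 1)
    refine ⟨fun j => Nat.casesOn j r fun j => c j / ((j : K) + 1), ?_, ?_⟩
    · intro j
      rcases j with _ | j
      · constructor
        · have hr : r ∈ fracPiece K ha i := by
            refine sub_mem hx (sum_mem fun j _ => ?_)
            have := mul_mem_fracPiece ha (hc' j).1 (pow_mem_fracPiece ha hs (j + 1))
            convert this using 2
            ring
          simpa using hr
        · change δ r = 0
          rw [map_sub, map_sum, sub_eq_zero]
          conv_lhs => rw [h1]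
          refine Finset.sum_congr rfl fun j _ => ?_
          rw [δ.apply_mul_of_left_eq_zero (hc' j).2, δ.leibniz_pow, hδs]
          have : (j : K) + 1 ≠ 0 := Nat.cast_add_one_ne_zero j
          simp only [Nat.add_sub_cancel, smul_eq_mul, nsmul_eq_mul]
          push_cast
          field_simp
      · exact hc' j
    · rw [Finset.sum_range_succ']
      simp [r]

/-- Powers of a are constants, so clearing denominators keeps constants constant. This turns the
degree of a constant coefficient into information about degrees of constants in B. -/
theorem exists_mem_of_mem_fracPiece_of_ne_zero [IsFractionRing B K] {i : ℤ} (ha0 : a ≠ 0)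
    (hδa : δ (ι a) = 0) {x : K}
    (hx : x ∈ fracPiece K ha i) (hx0 : x ≠ 0) (hδx : δ x = 0) :
    ∃ l : ℕ, ∃ b ∈ 𝒜 (i + l * n), b ≠ 0 ∧ δ (ι b) = 0 ∧ x * ι a ^ l = ι b := by
  obtain ⟨l, b, hb, h⟩ := hx
  refine ⟨l, b, hb, ?_, ?_, h⟩
  · rintro rfl
    rw [map_zero] at h
    exact mul_ne_zero hx0 (pow_ne_zero l (algebraMap_fractionRing_ne_zero ha0)) h
  · rw [← h, δ.apply_mul_of_left_eq_zero hδx, δ.apply_pow_of_eq_zero hδa, mul_zero]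

variable [IsDomain B]

/-- The group of degrees of the homogeneous fractions of constants. -/
def constantDegrees (𝒜 : ℤ → AddSubgroup B) [SetLike.GradedMonoid 𝒜]
    (δ : Derivation ℤ K K) : AddSubgroup ℤ where
  carrier := {l | ∃ i j : ℤ, ∃ g ∈ 𝒜 i, ∃ h ∈ 𝒜 j, g ≠ 0 ∧ h ≠ 0 ∧ δ (ι g) = 0 ∧ δ (ι h) = 0 ∧
    l = i - j}
  zero_mem' := ⟨0, 0, 1, SetLike.GradedOne.one_mem, 1, SetLike.GradedOne.one_mem, one_ne_zero,
    one_ne_zero, by simp, by simp, by simp⟩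
  add_mem' := by
    rintro _ _ ⟨i, j, g, hg, h, hh, hg0, hh0, hδg, hδh, rfl⟩
      ⟨i', j', g', hg', h', hh', hg0', hh0', hδg', hδh', rfl⟩
    refine ⟨i + i', j + j', g * g', SetLike.GradedMul.mul_mem hg hg', h * h',
      SetLike.GradedMul.mul_mem hh hh', mul_ne_zero hg0 hg0', mul_ne_zero hh0 hh0', ?_, ?_, ?_⟩
    · rw [map_mul, δ.apply_mul_of_left_eq_zero hδg, hδg', mul_zero]
    · rw [map_mul, δ.apply_mul_of_left_eq_zero hδh, hδh', mul_zero]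
    · ring
  neg_mem' := by
    rintro _ ⟨i, j, g, hg, h, hh, hg0, hh0, hδg, hδh, rfl⟩
    exact ⟨j, i, h, hh, g, hg, hh0, hg0, hδh, hδg, by ring⟩

theorem mem_constantDegrees_of_mem {i : ℤ} {g : B} (hg : g ∈ 𝒜 i) (hg0 : g ≠ 0)
    (hδg : δ (ι g) = 0) : i ∈ constantDegrees 𝒜 δ :=
  ⟨i, 0, g, hg, 1, SetLike.GradedOne.one_mem, hg0, one_ne_zero, hδg, by simp, by simp⟩

/-- An element with nonzero derivative is transcendental over the constants. -/
theorem aeval_injective_of_derivation_ne_zero [CharZero K]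
    (P : Subring K) (t : P) (ht : δ t ≠ 0) :
    Function.Injective (Polynomial.aeval (R := δ.constants.comap P.subtype) t) := by
  let A := δ.constants.comap P.subtype
  have h : Transcendental A (t : K) :=
    δ.transcendental_of_ne_zero (A := A) (fun x y h => Subtype.ext (Subtype.ext h))
      (fun x => x.2) ht
  rw [transcendental_iff_injective] at h
  intro p q hpq
  refine h ?_
  have h1 : ∀ p : Polynomial A, Polynomial.aeval (t : K) p =
      ((Polynomial.aeval t p : P) : K) := fun p =>
    Polynomial.aeval_algebraMap_apply K t p
  rw [h1, h1, hpq]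

/-- A nonzero homogeneous locally nilpotent derivation with a nonzero constant of nonzero degree
produces a cylinder. -/
theorem IsHomogeneousLND.exists_isPolynomialRing (h : IsHomogeneousLND 𝒜 δ e)
    [IsFractionRing B K] [CharZero K]
    (hdiv : ∀ (m : ℕ) (i : ℤ), ∀ b ∈ 𝒜 i, ∃ c ∈ 𝒜 i, ι b / ((m : K) + 1) = ι c)
    {i₀ : ℤ} {b₀ : B} (hb₀ : b₀ ∈ 𝒜 i₀) (hne : δ (ι b₀) ≠ 0)
    {n₀ : ℤ} {g₀ : B} (hg₀ : g₀ ∈ 𝒜 n₀) (hn₀ : n₀ ≠ 0) (hg₀0 : g₀ ≠ 0) (hδg₀ : δ (ι g₀) = 0) :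
    ∃ (f : B) (n : ℤ) (hf : f ∈ 𝒜 n), f ≠ 0 ∧ n ≠ 0 ∧
      IsPolynomialRingInOneVariable (fracSubring K hf) := by
  obtain ⟨τ, t₀, ht₀, a, ha, ha0, hδt₀, hδa⟩ := h.exists_localSlice hb₀ hne
  have hιa : ι a ≠ 0 := algebraMap_fractionRing_ne_zero ha0
  let G := constantDegrees 𝒜 δ
  -- The integers z with ze in G form a subgroup, and m is its nonnegative generator. It is nonzero
  -- because the subgroup contains n₀ ≠ 0.
  obtain ⟨m, hm0, hmG, hmdvd⟩ : ∃ m : ℕ, m ≠ 0 ∧ (-(m * e) : ℤ) ∈ G ∧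
      ∀ j : ℕ, (j * e : ℤ) ∈ G → m ∣ j := by
    let H : AddSubgroup ℤ := G.comap (AddMonoidHom.mulRight e)
    have hH : ∀ z : ℤ, z ∈ H ↔ z * e ∈ G := fun z => Iff.rfl
    obtain ⟨q, hq⟩ := Int.subgroup_cyclic H
    rw [← AddSubgroup.zmultiples_eq_closure] at hq
    have hqH : ∀ z : ℤ, z ∈ H ↔ q ∣ z := fun z => by rw [hq, Int.mem_zmultiples_iff]
    refine ⟨q.natAbs, ?_, neg_mem ?_, fun j hj => ?_⟩
    · intro h0
      have h1 : n₀ ∈ H := by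
        rw [hH, mul_comm, ← smul_eq_mul]
        exact zsmul_mem (mem_constantDegrees_of_mem hg₀ hg₀0 hδg₀) e
      rw [hqH, Int.natAbs_eq_zero.1 h0, zero_dvd_iff] at h1
      exact hn₀ h1
    · rw [← hH, hqH]
      exact Int.dvd_natAbs.2 dvd_rfl
    · rw [← hH, hqH] at hj
      exact Int.natAbs_dvd_natAbs.2 hj
  obtain ⟨i₁, j₁, g₁, hg₁, h₁, hh₁, hg₁0, hh₁0, hδg₁, hδh₁, hij⟩ := hmG
  have hιg₁ : ι g₁ ≠ 0 := algebraMap_fractionRing_ne_zero hg₁0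
  have hιh₁ : ι h₁ ≠ 0 := algebraMap_fractionRing_ne_zero hh₁0
  -- A cylinder needs nonzero degree; since n₀ ≠ 0, r = 0 and r = 1 cannot both fail.
  obtain ⟨r, hr⟩ : ∃ r : ℕ, τ + e + (i₁ + (j₁ + r * n₀)) ≠ 0 := by
    by_contra! hcon
    have h1 := hcon 0
    have h2 := hcon 1
    push_cast at h1 h2
    omega
  have hg₀r : g₀ ^ r ∈ 𝒜 (r * n₀) := by
    have := SetLike.pow_mem_graded r hg₀
    rwa [nsmul_eq_mul] at this
  -- Inverting a puts s in B[1/f]; inverting g₁ and h₁ puts u = g₁/h₁ and its inverse there. All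
  -- factors are constants, so f is too.
  let f := a * (g₁ * (h₁ * g₀ ^ r))
  have hf : f ∈ 𝒜 (τ + e + (i₁ + (j₁ + r * n₀))) :=
    SetLike.GradedMul.mul_mem ha
      (SetLike.GradedMul.mul_mem hg₁ (SetLike.GradedMul.mul_mem hh₁ hg₀r))
  have hf0 : f ≠ 0 :=
    mul_ne_zero ha0 (mul_ne_zero hg₁0 (mul_ne_zero hh₁0 (pow_ne_zero r hg₀0)))
  have hιf : ι f ≠ 0 := algebraMap_fractionRing_ne_zero hf0
  have hδf : δ (ι f) = 0 := by
    have hmem : ι f ∈ δ.constants := by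
      simp only [f, map_mul, map_pow]
      exact mul_mem hδa (mul_mem hδg₁ (mul_mem hδh₁ (pow_mem hδg₀ r)))
    exact hmem
  have hle := fracPiece_le_of_mul_eq (K := K) ha (SetLike.GradedMul.mul_mem hg₁
    (SetLike.GradedMul.mul_mem hh₁ hg₀r)) hf rfl rfl
  set s : K := ι t₀ / ι a with hs_def
  have hsa : s ∈ fracPiece K ha (-e) := by
    refine ⟨1, t₀, ?_, ?_⟩
    · convert ht₀ using 2
      push_cast; ring
    · rw [pow_one, div_mul_cancel₀ _ hιa]
  have hδs : δ s = 1 := by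
    rw [hs_def, div_eq_mul_inv, mul_comm, δ.apply_mul_of_left_eq_zero (δ.apply_inv_of_eq_zero hδa),
      hδt₀, inv_mul_cancel₀ hιa]
  set u : K := ι g₁ * (ι h₁)⁻¹ with hu_def
  have hu0 : u ≠ 0 := mul_ne_zero hιg₁ (inv_ne_zero hιh₁)
  have hδu : δ u = 0 := by
    rw [hu_def, δ.apply_mul_of_left_eq_zero hδg₁, δ.apply_inv_of_eq_zero hδh₁, mul_zero]
  have hu : u ∈ fracPiece K hf (-(m * e)) := by
    have h1 := inv_mem_fracPiece_of_mul_eq (K := K) hf hf0 (h := h₁) (j := j₁)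
      (SetLike.GradedMul.mul_mem ha (SetLike.GradedMul.mul_mem hg₁ hg₀r)) (by ring)
      (by simp only [f]; ring)
    have h2 := mul_mem_fracPiece hf (algebraMap_mem_fracPiece hf hg₁) h1
    rwa [← sub_eq_add_neg, ← hij] at h2
  have hu' : u⁻¹ ∈ fracPiece K hf (m * e) := by
    have h1 := inv_mem_fracPiece_of_mul_eq (K := K) hf hf0 (h := g₁) (j := i₁)
      (SetLike.GradedMul.mul_mem ha (SetLike.GradedMul.mul_mem hh₁ hg₀r)) (by ring)
      (by simp only [f]; ring)
    have h2 := mul_mem_fracPiece hf (algebraMap_mem_fracPiece hf hh₁) h1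
    rw [hu_def, mul_inv, inv_inv, mul_comm (ι g₁)⁻¹]
    convert h2 using 2
    linarith
  -- The degrees -me and me cancel. This element is the variable.
  have ht : s ^ m * u⁻¹ ∈ fracSubring K hf := by
    have := mul_mem_fracPiece hf (pow_mem_fracPiece hf (hle _ hsa) m) hu'
    rw [mem_fracSubring]
    convert this using 2
    ring
  refine ⟨f, _, hf, hf0, hr, ?_⟩
  let t : fracSubring K hf := ⟨s ^ m * u⁻¹, ht⟩
  have hs0 : s ≠ 0 := by
    intro h0
    rw [h0, map_zero] at hδs
    exact zero_ne_one hδs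
  have hδt : δ (t : K) ≠ 0 := by
    change δ (s ^ m * u⁻¹) ≠ 0
    rw [mul_comm, δ.apply_mul_of_left_eq_zero (δ.apply_inv_of_eq_zero hδu), δ.leibniz_pow, hδs,
      smul_eq_mul, mul_one, nsmul_eq_mul]
    exact mul_ne_zero (inv_ne_zero hu0)
      (mul_ne_zero (Nat.cast_ne_zero.2 hm0) (pow_ne_zero _ hs0))
  refine ⟨δ.constants.comap (fracSubring K hf).subtype,
    ⟨(AlgEquiv.ofBijective (Polynomial.aeval t) ⟨?_, ?_⟩).symm⟩⟩
  · exact aeval_injective_of_derivation_ne_zero (fracSubring K hf) t hδt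
  let A := δ.constants.comap (fracSubring K hf).subtype
  let T : AddSubgroup K :=
    ((Polynomial.aeval (R := A) t).toRingHom.range.map (fracSubring K hf).subtype).toAddSubgroup
  have hT : ∀ x, x ∈ T ↔ ∃ p : Polynomial A,
      ((Polynomial.aeval t p : fracSubring K hf) : K) = x := by
    intro x
    constructor
    · rintro ⟨_, ⟨p, rfl⟩, rfl⟩
      exact ⟨p, rfl⟩
    · rintro ⟨p, rfl⟩
      exact ⟨_, ⟨p, rfl⟩, rfl⟩
  rintro ⟨x, hx⟩
  suffices H : x ∈ T by
    obtain ⟨p, hp⟩ := (hT x).1 H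
    exact ⟨p, Subtype.ext hp⟩
  obtain ⟨l, b, hb, hxb⟩ := hx
  obtain ⟨N, hN⟩ := h.nilpotent _ b hb
  obtain ⟨c, hc, hsum⟩ := h.exists_eq_sum ha hdiv hδa hsa hδs N _ (ι b)
    (algebraMap_mem_fracPiece ha hb) hN
  have hx' : x = ∑ j ∈ Finset.range N, c j * s ^ j * (ι f ^ l)⁻¹ := by
    rw [← Finset.sum_mul, ← hsum, ← hxb, mul_inv_cancel_right₀ (pow_ne_zero l hιf)]
  rw [hx']
  refine sum_mem fun j _ => ?_
  by_cases hcj : c j = 0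
  · rw [hcj, zero_mul, zero_mul]
    exact zero_mem _
  -- A nonzero coefficient c j has degree deg b + je, where deg b = l · deg f. Clearing its
  -- denominators, then subtracting the degrees of powers of f and a, leaves je in G.
  obtain ⟨q, rfl⟩ : m ∣ j := by
    obtain ⟨l', b', hb', hb'0, hδb', -⟩ :=
      exists_mem_of_mem_fracPiece_of_ne_zero ha ha0 hδa (hc j).1 hcj (hc j).2
    have h1 := mem_constantDegrees_of_mem hb' hb'0 hδb'
    have h2 := nsmul_mem (mem_constantDegrees_of_mem hf hf0 hδf) l
    have h3 := nsmul_mem (mem_constantDegrees_of_mem ha ha0 hδa) l'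
    refine hmdvd j ?_
    have h4 := sub_mem (sub_mem h1 h2) h3
    rw [nsmul_eq_mul, nsmul_eq_mul] at h4
    convert h4 using 1
    ring
  have hfl : (ι f ^ l)⁻¹ ∈ fracPiece K hf (-(l * (τ + e + (i₁ + (j₁ + r * n₀))))) := by
    have := zpow_mem_fracPiece (K := K) hf hf0 (-l)
    rw [zpow_neg, zpow_natCast] at this
    convert this using 2
    ring
  -- Since s^(mq) = u^q t^q, this is the coefficient of t^q: a constant of degree 0.
  have hcoef : c (m * q) * u ^ q * (ι f ^ l)⁻¹ ∈ fracSubring K hf := by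
    have := mul_mem_fracPiece hf
      (mul_mem_fracPiece hf (hle _ (hc (m * q)).1) (pow_mem_fracPiece hf hu q)) hfl
    rw [mem_fracSubring]
    convert this using 2
    push_cast; ring
  have hcoefA : (⟨_, hcoef⟩ : fracSubring K hf) ∈ A := by
    change _ ∈ δ.constants
    have h1 : u ∈ δ.constants := hδu
    have h2 : c (m * q) ∈ δ.constants := (hc _).2
    have h3 : (ι f ^ l)⁻¹ ∈ δ.constants := δ.apply_inv_of_eq_zero (δ.apply_pow_of_eq_zero hδf l)
    exact mul_mem (mul_mem h2 (pow_mem h1 q)) h3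
  refine (hT _).2 ⟨Polynomial.C ⟨_, hcoefA⟩ * Polynomial.X ^ q, ?_⟩
  rw [map_mul, map_pow, Polynomial.aeval_X, Polynomial.aeval_C]
  change c (m * q) * u ^ q * (ι f ^ l)⁻¹ * (s ^ m * u⁻¹) ^ q = _
  rw [mul_pow (s ^ m), inv_pow, ← pow_mul]
  field_simp

end HomogeneousDerivation

/-! ### A non-rigid Veronese subring yields a cylindrical element. -/

section NonRigidVeronese

variable {B : Type*} [CommRing B] {K : Type*} [Field K] [Algebra B K]
  [IsFractionRing B K]

local notation "ι" => algebraMap B K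

section ConstantsInDegreeZero

variable {𝒜 : ℤ → AddSubgroup B} [SetLike.GradedMonoid 𝒜] {δ : Derivation ℤ K K} {e : ℤ}

/-- If all constants have degree zero, then a homogeneous element is a polynomial in a homogeneous
slice `s = t / a` with coefficients that are fractions of elements of degree zero, and its degree
is a multiple of the degree of `s`. -/
theorem IsHomogeneousLND.exists_eq_sum_of_constants_degree_zero (h : IsHomogeneousLND 𝒜 δ e)
    [CharZero K]
    (hdiv : ∀ (m : ℕ) (i : ℤ), ∀ b ∈ 𝒜 i, ∃ c ∈ 𝒜 i, ι b / ((m : K) + 1) = ι c)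
    (hconst : ∀ i, ∀ g ∈ 𝒜 i, g ≠ 0 → δ (ι g) = 0 → i = 0)
    {i₀ : ℤ} {b₀ : B} (hb₀ : b₀ ∈ 𝒜 i₀) (hne : δ (ι b₀) ≠ 0) :
    ∃ t : B, ∃ a ∈ 𝒜 0, a ≠ 0 ∧ ∀ i, ∀ b ∈ 𝒜 i, (b ≠ 0 → ∃ j : ℕ, i + j * e = 0) ∧
      ∃ (N : ℕ) (c : ℕ → K), (∀ j, ∃ l : ℕ, ∃ b' ∈ 𝒜 0, c j * ι a ^ l = ι b') ∧
        ι b = ∑ j ∈ Finset.range N, c j * (ι t / ι a) ^ j := by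
  obtain ⟨τ, t, ht, a, ha, ha0, hδt, hδa⟩ := h.exists_localSlice hb₀ hne
  have hιa : ι a ≠ 0 := algebraMap_fractionRing_ne_zero ha0
  have hτ : τ + e = 0 := hconst _ a ha ha0 hδa
  have hsa : ι t / ι a ∈ fracPiece K ha (-e) := by
    refine ⟨1, t, ?_, ?_⟩
    · convert ht using 2
      push_cast; ring
    · rw [pow_one, div_mul_cancel₀ _ hιa]
  have hδs : δ (ι t / ι a) = 1 := by
    rw [div_eq_mul_inv, mul_comm, δ.apply_mul_of_left_eq_zero (δ.apply_inv_of_eq_zero hδa),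
      hδt, inv_mul_cancel₀ hιa]
  refine ⟨t, a, hτ ▸ ha, ha0, fun i b hb => ?_⟩
  obtain ⟨N, hN⟩ := h.nilpotent _ b hb
  obtain ⟨c, hc, hsum⟩ := h.exists_eq_sum ha hdiv hδa hsa hδs N _ (ι b)
    (algebraMap_mem_fracPiece ha hb) hN
  -- Here a has degree 0, so multiplying c j by a power of a gives a constant in B of degree i + je,
  -- which must then be 0.
  have key : ∀ j, c j ≠ 0 → i + j * e = 0 ∧ ∃ l : ℕ, ∃ b' ∈ 𝒜 0, c j * ι a ^ l = ι b' := by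
    intro j hj
    obtain ⟨l, b', hb', hb'0, hδb', heq⟩ :=
      exists_mem_of_mem_fracPiece_of_ne_zero ha ha0 hδa (hc j).1 hj (hc j).2
    have h1 := hconst _ b' hb' hb'0 hδb'
    refine ⟨?_, l, b', h1 ▸ hb', heq⟩
    rwa [hτ, mul_zero, add_zero] at h1
  refine ⟨fun hb0 => ?_, N, c, fun j => ?_, hsum⟩
  · by_contra! hcon
    refine algebraMap_fractionRing_ne_zero (K := K) hb0 ?_
    rw [hsum]
    refine Finset.sum_eq_zero fun j _ => ?_
    by_cases hj : c j = 0
    · rw [hj, zero_mul]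
    · exact absurd (key j hj).1 (hcon j)
  · by_cases hj : c j = 0
    · exact ⟨0, 0, zero_mem _, by rw [hj, zero_mul, map_zero]⟩
    · exact (key j hj).2

end ConstantsInDegreeZero

variable [IsDomain B] {𝒜 : ℤ → AddSubgroup B} [GradedRing 𝒜]

/-- The pieces of degree divisible by d need not exhaust B, so they need not grade it.
Multiplicativity suffices for `fracPiece` and lets elements of the Veronese subring be treated as
elements of B. -/
instance veronesePieces_gradedMonoid (d : ℤ) : SetLike.GradedMonoid fun i => 𝒜 (d * i) where
  one_mem := by
    rw [mul_zero]
    exact SetLike.GradedOne.one_mem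
  mul_mem i j x y hx hy := by
    rw [mul_add]
    exact SetLike.GradedMul.mul_mem hx hy

/-- A nonzero homogeneous locally nilpotent derivation of a Veronese subring has a nonzero constant
of nonzero degree, if `B` is not too small. -/
theorem IsHomogeneousLND.exists_constant_degree_ne_zero [CharZero K] {d : ℕ} (hd : 1 ≤ d)
    {δ : Derivation ℤ K K} {e : ℤ} (h : IsHomogeneousLND (fun i => 𝒜 (d * i)) δ e)
    (hdiv : ∀ (m : ℕ) (i : ℤ), ∀ b ∈ 𝒜 i, ∃ c ∈ 𝒜 i, ι b / ((m : K) + 1) = ι c)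
    {i₀ : ℤ} {b₀ : B} (hb₀ : b₀ ∈ 𝒜 (d * i₀)) (hne : δ (ι b₀) ≠ 0)
    (hB : 2 ≤ Algebra.trdeg (SetLike.GradeZero.subring 𝒜) B ∨
      ∃ i j : ℤ, i < 0 ∧ 0 < j ∧ 𝒜 i ≠ ⊥ ∧ 𝒜 j ≠ ⊥) :
    ∃ i, i ≠ 0 ∧ ∃ g ∈ 𝒜 (d * i), g ≠ 0 ∧ δ (ι g) = 0 := by
  classical
  by_contra! hcon
  have hconst : ∀ i, ∀ g ∈ 𝒜 (d * i), g ≠ 0 → δ (ι g) = 0 → i = 0 := by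
    intro i g hg hg0 hδg
    by_contra hi
    exact hcon i hi g hg hg0 hδg
  obtain ⟨t, a, ha, ha0, H⟩ := h.exists_eq_sum_of_constants_degree_zero
    (fun m i => hdiv m (d * i)) hconst hb₀ hne
  have hpow : ∀ {i : ℤ} {b : B}, b ∈ 𝒜 i → b ^ d ∈ 𝒜 (d * i) := by
    intro i b hb
    have := SetLike.pow_mem_graded d hb
    rwa [nsmul_eq_mul] at this
  rcases hB with hB | ⟨i, j, hi, hj, hBi, hBj⟩
  -- The expansions in t/a show that d-th powers of homogeneous elements, hence all of B, are
  -- algebraic over B₀[t]. The transcendence degree is then at most 1.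
  · let B₀ := SetLike.GradeZero.subring 𝒜
    let A := Algebra.adjoin B₀ {t}
    have hzero : ∀ x ∈ 𝒜 (d * 0), IsAlgebraic A (ι x) := by
      intro x hx
      rw [mul_zero] at hx
      exact isAlgebraic_algebraMap (R := A) (A := K)
        (algebraMap B₀ A (⟨x, hx⟩ : B₀))
    have ht : IsAlgebraic A (ι t) :=
      isAlgebraic_algebraMap (R := A) (A := K) ⟨t, Algebra.subset_adjoin rfl⟩
    have halg : ∀ i, ∀ b ∈ 𝒜 (d * i), IsAlgebraic A (ι b) := by
      intro i b hb
      obtain ⟨-, N, c, hc, hsum⟩ := H i b hb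
      rw [hsum]
      refine Finset.sum_induction _ (IsAlgebraic A) (fun _ _ => .add) isAlgebraic_zero fun j _ => ?_
      obtain ⟨l, b', hb', hcb⟩ := hc j
      have hc' : c j = ι b' * (ι a ^ l)⁻¹ := by
        rw [← hcb, mul_inv_cancel_right₀
          (pow_ne_zero l (algebraMap_fractionRing_ne_zero ha0))]
      rw [hc', div_eq_mul_inv]
      exact ((hzero b' hb').mul ((hzero a ha).pow l).inv).mul ((ht.mul (hzero a ha).inv).pow j)
    have : Algebra.IsAlgebraic A B := by
      refine ⟨fun b => ?_⟩
      rw [← DirectSum.sum_support_decompose 𝒜 b]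
      refine Finset.sum_induction _ (IsAlgebraic A) (fun _ _ => .add) isAlgebraic_zero fun i _ => ?_
      refine IsAlgebraic.of_pow hd ?_
      have := halg i _ (hpow (SetLike.coe_mem (DirectSum.decompose 𝒜 b i)))
      exact (isAlgebraic_algebraMap_iff (IsFractionRing.injective B K)).1 this
    have h1 := Algebra.IsAlgebraic.trdeg_le_cardinalMk B₀ ({t} : Set B)
    rw [Cardinal.mk_singleton] at h1
    exact absurd (hB.trans h1) (by simp)
  · obtain ⟨⟨x, hx⟩, hx0⟩ := AddSubgroup.ne_bot_iff_exists_ne_zero.1 hBi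
    obtain ⟨⟨y, hy⟩, hy0⟩ := AddSubgroup.ne_bot_iff_exists_ne_zero.1 hBj
    replace hx0 : x ≠ 0 := fun h => hx0 (Subtype.ext h)
    replace hy0 : y ≠ 0 := fun h => hy0 (Subtype.ext h)
    -- Now i = -pe and j = -qe with p, q ≥ 0, so i and j cannot have opposite signs.
    obtain ⟨p, hp⟩ := (H i _ (hpow hx)).1 (pow_ne_zero d hx0)
    obtain ⟨q, hq⟩ := (H j _ (hpow hy)).1 (pow_ne_zero d hy0)
    have hp0 : (0 : ℤ) ≤ p := Int.natCast_nonneg p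
    have hq0 : (0 : ℤ) ≤ q := Int.natCast_nonneg q
    rcases le_total e 0 with he | he
    · nlinarith
    · nlinarith

/-- If some Veronese subring is not rigid, then there is a cylindrical element. -/
theorem exists_isCylindrical_of_not_isRigidRing {k : Type*} [Field k] [CharZero k] [Algebra k B]
    [Algebra.FiniteType k B] (K : Type*) [Field K] [Algebra B K] [IsFractionRing B K]
    (hB : 2 ≤ Algebra.trdeg (SetLike.GradeZero.subring 𝒜) B ∨
      ∃ i j : ℤ, i < 0 ∧ 0 < j ∧ 𝒜 i ≠ ⊥ ∧ 𝒜 j ≠ ⊥)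
    {d : ℕ} (hd : 1 ≤ d) (hrigid : ¬ IsRigidRing (veroneseSubring 𝒜 d)) :
    ∃ f : B, IsCylindrical 𝒜 f := by
  have hBchar : CharZero B := charZero_of_injective_algebraMap (algebraMap k B).injective
  have hKchar : CharZero K := charZero_of_injective_algebraMap (IsFractionRing.injective B K)
  have hd0 : (d : ℤ) ≠ 0 := by exact_mod_cast (by omega : d ≠ 0)
  let V := veroneseSubring 𝒜 d
  let _ : Algebra k V := veroneseAlgebra 𝒜 k d
  have : Algebra.FiniteType k V := veroneseSubring_finiteType 𝒜 k hd
  let _ : GradedRing (veroneseGrading 𝒜 d) := veroneseGradedRing 𝒜 hd0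
  obtain ⟨D₀, hD₀, hD₀0⟩ : ∃ D : Derivation ℤ V V, IsLocallyNilpotentDerivation D ∧ D ≠ 0 := by
    simpa [IsRigidRing] using hrigid
  obtain ⟨e, D, hD0, hD, hhom⟩ := hD₀.exists_homogeneous (k := k) (veroneseGrading 𝒜 d) hD₀0
  have := veroneseSubring_isIntegral 𝒜 hd
  have : Algebra.IsAlgebraic B K := IsLocalization.isAlgebraic K (nonZeroDivisors B)
  have : Algebra.IsAlgebraic V K := Algebra.IsAlgebraic.trans V B K
  obtain ⟨δ, hδ⟩ := Derivation.exists_extend_of_isAlgebraic (R := V) (K := K)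
    ((IsFractionRing.injective B K).comp Subtype.val_injective)
    ((Algebra.linearMap V K).compDer D)
  replace hδ : ∀ v : V, δ (algebraMap B K v) = algebraMap B K (D v) := hδ
  have hiter : ∀ (n : ℕ) (v : V), δ^[n] (algebraMap B K v) = algebraMap B K (D^[n] v : V) := by
    intro n
    induction n with
    | zero => exact fun v => rfl
    | succ n ih => intro v; rw [Function.iterate_succ_apply, hδ, ih, Function.iterate_succ_apply]
  have hLND : IsHomogeneousLND (fun i => 𝒜 (d * i)) δ e := by
    refine ⟨fun i b hb => ?_, fun i b hb => ?_⟩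
    · exact ⟨_, hhom i ⟨b, mem_veroneseSubring_of_mem 𝒜 hb⟩ hb,
        hδ ⟨b, mem_veroneseSubring_of_mem 𝒜 hb⟩⟩
    · obtain ⟨n, _, hn⟩ := hD ⟨b, mem_veroneseSubring_of_mem 𝒜 hb⟩
      refine ⟨n, ?_⟩
      have := hiter n ⟨b, mem_veroneseSubring_of_mem 𝒜 hb⟩
      rw [hn] at this
      simpa using this
  have hdiv : ∀ (m : ℕ) (i : ℤ), ∀ b ∈ 𝒜 i, ∃ c ∈ 𝒜 i,
      algebraMap B K b / ((m : K) + 1) = algebraMap B K c := by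
    intro m i b hb
    refine ⟨algebraMap k B ((m : k) + 1)⁻¹ * b, ?_, ?_⟩
    · have := SetLike.GradedMul.mul_mem (GradedRing.algebraMap_mem_zero 𝒜 ((m : k) + 1)⁻¹) hb
      rwa [zero_add] at this
    · have h1 : (m : k) + 1 ≠ 0 := Nat.cast_add_one_ne_zero m
      have h2 : (m : K) + 1 ≠ 0 := Nat.cast_add_one_ne_zero m
      have h3 : ((m : K) + 1) * algebraMap B K (algebraMap k B ((m : k) + 1)⁻¹) = 1 := by
        have := congrArg (fun x => algebraMap B K (algebraMap k B x)) (mul_inv_cancel₀ h1)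
        simpa only [map_mul, map_add, map_natCast, map_one] using this
      rw [div_eq_iff h2, map_mul, mul_comm, ← mul_assoc, h3, one_mul]
  obtain ⟨i₀, b₀, hb₀, hne⟩ : ∃ i₀, ∃ b₀ ∈ 𝒜 (d * i₀), δ (algebraMap B K b₀) ≠ 0 := by
    by_contra! hcon
    refine hD0 (Derivation.ext fun v => ?_)
    have h1 : δ (algebraMap B K v) = 0 := by
      refine veroneseSubring_induction 𝒜 (motive := fun x => δ (algebraMap B K x) = 0) v.2
        (by rw [map_zero, map_zero]) (fun x y hx hy => by rw [map_add, map_add, hx, hy, add_zero])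
        (fun i x hx => hcon i x hx)
    rw [hδ] at h1
    exact Subtype.ext (IsFractionRing.injective B K (h1.trans (map_zero _).symm))
  obtain ⟨n₀, hn₀, g₀, hg₀, hg₀0, hδg₀⟩ :=
    hLND.exists_constant_degree_ne_zero hd hdiv hb₀ hne hB
  obtain ⟨f, n, hf, hf0, hn, hpoly⟩ := hLND.exists_isPolynomialRing
    (fun m i => hdiv m (d * i)) hb₀ hne hg₀ hn₀ hg₀0 hδg₀
  refine ⟨f, hf0, ⟨d * n, mul_ne_zero hd0 hn, hf⟩, ?_⟩
  rw [isPolynomialRingInOneVariable_away_iff K hf hf0]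
  -- The numerators of degree-zero fractions have degree a multiple of deg f = dn, so passing to the
  -- Veronese pieces loses nothing.
  have heq : fracSubring (𝒜 := 𝒜) K hf = fracSubring (𝒜 := fun i => 𝒜 (d * i)) K (n := n) hf := by
    ext x
    rw [mem_fracSubring, mem_fracSubring, mem_fracPiece, mem_fracPiece]
    refine exists_congr fun l => exists_congr fun b => and_congr_left fun _ => ?_
    rw [show (0 : ℤ) + l * (d * n) = d * (0 + l * n) by ring]
  rw [heq]
  exact hpoly

end NonRigidVeronese

/-! ### The derivative with respect to the variable of a cylinder. -/

section PolynomialDerivation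

/-- The derivation with respect to the variable on a ring isomorphic to a polynomial ring. -/
noncomputable def RingEquiv.polynomialDerivation {P A : Type*} [CommRing P] [CommRing A]
    (φ : P ≃+* Polynomial A) : Derivation ℤ P P :=
  Derivation.mk'
    ((φ.symm.toAddMonoidHom.comp Polynomial.derivative.toAddMonoidHom).comp
      φ.toAddMonoidHom).toIntLinearMap fun a b => by
    change φ.symm (Polynomial.derivative (φ (a * b))) =
      a * φ.symm (Polynomial.derivative (φ b)) + b * φ.symm (Polynomial.derivative (φ a))
    apply φ.injective
    simp only [map_mul, map_add, RingEquiv.apply_symm_apply, Polynomial.derivative_mul]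
    ring

variable {P A : Type*} [CommRing P] [CommRing A] (φ : P ≃+* Polynomial A)

theorem RingEquiv.map_polynomialDerivation (p : P) :
    φ (φ.polynomialDerivation p) = Polynomial.derivative (φ p) :=
  φ.apply_symm_apply _

theorem RingEquiv.polynomialDerivation_isLocallyNilpotent :
    IsLocallyNilpotentDerivation φ.polynomialDerivation := by
  intro p
  refine ⟨(φ p).natDegree + 1, by omega, φ.injective ?_⟩
  have h : ∀ n : ℕ, φ (φ.polynomialDerivation^[n] p) = Polynomial.derivative^[n] (φ p) := by
    intro n
    induction n with
    | zero => rfl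
    | succ n ih =>
      rw [Function.iterate_succ_apply', Function.iterate_succ_apply',
        φ.map_polynomialDerivation, ih]
  rw [h, map_zero]
  exact Polynomial.iterate_derivative_eq_zero (Nat.lt_succ_self _)

end PolynomialDerivation

theorem Derivation.exists_restrict {V K : Type*} [CommRing V] [CommRing K] [Algebra V K]
    (hinj : Function.Injective (algebraMap V K)) (Δ : Derivation ℤ K K)
    (h : ∀ v : V, ∃ w : V, Δ (algebraMap V K v) = algebraMap V K w) :
    ∃ D : Derivation ℤ V V, ∀ v, algebraMap V K (D v) = Δ (algebraMap V K v) := by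
  choose g hg using h
  have hadd : ∀ a b, g (a + b) = g a + g b := fun a b => hinj (by
    rw [← hg, map_add, map_add, map_add, hg, hg])
  refine ⟨Derivation.mk' (AddMonoidHom.mk' g hadd).toIntLinearMap fun a b => hinj ?_,
    fun v => (hg v).symm⟩
  change algebraMap V K (g (a * b)) = algebraMap V K (a * g b + b * g a)
  rw [← hg, map_mul, Derivation.leibniz, map_add, map_mul, map_mul, hg, hg, smul_eq_mul,
    smul_eq_mul]

/-! ### Extending a derivation of B_(f) to the fraction field. -/

section Cylinder

variable {B : Type*} [CommRing B] {K : Type*} [Field K] [Algebra B K]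
  [IsFractionRing B K] {𝒜 : ℤ → AddSubgroup B} [GradedRing 𝒜] {f : B} {n : ℤ} (hf : f ∈ 𝒜 n)

local notation "ι" => algebraMap B K

theorem mul_zpow_mem_fracSubring (hf0 : f ≠ 0) {i j : ℤ} (hij : j * n = i) {x : K}
    (hx : x ∈ fracPiece K hf i) : x * ι f ^ (-j) ∈ fracSubring K hf := by
  have := mul_mem_fracPiece hf hx (zpow_mem_fracPiece (K := K) hf hf0 (-j))
  rw [mem_fracSubring]
  convert this using 2
  rw [← hij]; ring

/-- Handles n < 0: an element of B^(|n|) homogeneous of degree |n|i is an integral power of f times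
an element of B_(f). -/
theorem exists_mul_eq_natAbs_mul (n i : ℤ) : ∃ j : ℤ, j * n = n.natAbs * i := by
  refine ⟨n.sign * i, ?_⟩
  rw [mul_right_comm, Int.sign_mul_self_eq_natAbs]

/-- A homogeneous element of nonzero degree is transcendental over the degree-zero part. -/
theorem transcendental_fracSubring (hf0 : f ≠ 0) (hn : n ≠ 0) :
    Transcendental (fracSubring K hf) (ι f) := by
  have hιf : ι f ≠ 0 := algebraMap_fractionRing_ne_zero hf0
  rintro ⟨p, hp0, hp⟩
  refine hp0 ?_
  have hex : ∀ i, ∃ l : ℕ, ∃ b ∈ 𝒜 (0 + l * n), (p.coeff i : K) * ι f ^ l = ι b :=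
    fun i => (p.coeff i).2
  choose l b hb hlb using hex
  -- A common factor f^L clears all denominators of a relation. Its terms then have the distinct
  -- degrees (L + i)n and vanish separately.
  obtain ⟨L, hL⟩ : ∃ L, ∀ i ∈ p.support, l i ≤ L :=
    ⟨p.support.sup l, fun i hi => Finset.le_sup hi⟩
  have hmem : ∀ i ∈ p.support, b i * f ^ (L - l i) * f ^ i ∈ 𝒜 ((L + i) * n) := by
    intro i hi
    have := SetLike.GradedMul.mul_mem (SetLike.GradedMul.mul_mem (hb i)
      (SetLike.pow_mem_graded (L - l i) hf)) (SetLike.pow_mem_graded i hf)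
    convert this using 2
    rw [nsmul_eq_mul, nsmul_eq_mul, Nat.cast_sub (hL i hi)]
    ring
  have hval : ∀ i ∈ p.support, ι (b i * f ^ (L - l i) * f ^ i) =
      (p.coeff i : K) * ι f ^ i * ι f ^ L := by
    intro i hi
    rw [map_mul, map_mul, ← hlb, map_pow, map_pow, mul_assoc (p.coeff i : K), ← pow_add,
      Nat.add_sub_cancel' (hL i hi)]
    ring
  have hsum : ∑ i ∈ p.support, b i * f ^ (L - l i) * f ^ i = 0 := by
    apply IsFractionRing.injective B K
    rw [map_sum, map_zero, Finset.sum_congr rfl hval, ← Finset.sum_mul]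
    rw [Polynomial.aeval_def, Polynomial.eval₂_eq_sum, Polynomial.sum] at hp
    exact (congrArg (· * ι f ^ L) hp).trans (zero_mul _)
  have hz := GradedRing.eq_zero_of_sum_eq_zero 𝒜 (g := fun i : ℕ => ((L : ℤ) + i) * n)
    (fun i j hij => by simpa [hn] using hij) hmem hsum
  rw [← Polynomial.support_eq_empty, Finset.eq_empty_iff_forall_notMem]
  intro i hi
  have h1 := hval i hi
  rw [hz i hi, map_zero, eq_comm, mul_assoc] at h1
  have h2 : (p.coeff i : K) = 0 := (mul_eq_zero.1 h1).resolve_right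
    (mul_ne_zero (pow_ne_zero _ hιf) (pow_ne_zero _ hιf))
  exact Polynomial.mem_support_iff.1 hi (Subtype.ext h2)

/-- Some b f^l is homogeneous, so its factor b is homogeneous as well, and comparing degrees
identifies its degree. -/
theorem mem_of_algebraMap_mem_fracPiece [IsDomain B] (hf0 : f ≠ 0) {i : ℤ} {b : B}
    (hb : ι b ∈ fracPiece K hf i) : b ∈ 𝒜 i := by
  by_cases hb0 : b = 0
  · rw [hb0]; exact zero_mem _
  obtain ⟨l, c, hc, h⟩ := hb
  rw [← map_pow, ← map_mul] at h
  have h1 : b * f ^ l ∈ 𝒜 (i + l * n) := IsFractionRing.injective B K h ▸ hc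
  have h2 : b * f ^ l ≠ 0 := mul_ne_zero hb0 (pow_ne_zero l hf0)
  obtain ⟨j, hj⟩ := GradedRing.exists_mem_of_mul_mem 𝒜 h1 h2
  have h3 := GradedRing.degree_eq 𝒜 h1
    (SetLike.GradedMul.mul_mem hj (SetLike.pow_mem_graded l hf)) h2
  rw [nsmul_eq_mul, add_left_inj] at h3
  rwa [h3]

/-- A derivation of the degree-zero part of `B[1/f]` extends to the fraction field in such a way
that `f` is a constant. -/
theorem exists_derivation_extending [CharZero K] (hf0 : f ≠ 0) (hn : n ≠ 0)
    (D : Derivation ℤ (fracSubring K hf) (fracSubring K hf)) :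
    ∃ δ : Derivation ℤ K K, δ (ι f) = 0 ∧ ∀ p : fracSubring K hf, δ p = D p := by
  classical
  let P := fracSubring K hf
  -- P[X] embeds in K by X ↦ f. Differentiating coefficients kills X, so extending this derivation
  -- makes f a constant.
  let _ : Differential P := ⟨D⟩
  let _ : Algebra (Polynomial P) K := (Polynomial.aeval (R := P) (ι f)).toRingHom.toAlgebra
  have hmap : ∀ q : Polynomial P, algebraMap (Polynomial P) K q = Polynomial.aeval (ι f) q :=
    fun q => rfl
  have hinj : Function.Injective (algebraMap (Polynomial P) K) :=
    transcendental_iff_injective.1 (transcendental_fracSubring hf hf0 hn)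
  have hC : ∀ p : P, algebraMap (Polynomial P) K (Polynomial.C p) = p := fun p => by
    rw [hmap, Polynomial.aeval_C]; rfl
  have hX : algebraMap (Polynomial P) K Polynomial.X = ι f := by
    rw [hmap, Polynomial.aeval_X]
  have halgP : ∀ p ∈ P, IsAlgebraic (Polynomial P) p := fun p hp => by
    have := isAlgebraic_algebraMap (R := Polynomial P) (A := K) (Polynomial.C ⟨p, hp⟩)
    rwa [hC] at this
  have halgf : IsAlgebraic (Polynomial P) (ι f) := hX ▸ isAlgebraic_algebraMap _
  have halgB : ∀ b : B, IsAlgebraic (Polynomial P) (ι b) := by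
    intro b
    rw [← DirectSum.sum_support_decompose 𝒜 b, map_sum]
    refine Finset.sum_induction _ (IsAlgebraic (Polynomial P)) (fun _ _ => .add) isAlgebraic_zero
      fun i _ => ?_
    -- The |n|-th power of a homogeneous element has degree divisible by n, hence is p f^j with p in
    -- P.
    refine IsAlgebraic.of_pow (Int.natAbs_pos.2 hn) ?_
    obtain ⟨j, hj⟩ := exists_mul_eq_natAbs_mul n i
    have h1 := mul_zpow_mem_fracSubring hf hf0 hj (pow_mem_fracPiece (K := K) hf
      (algebraMap_mem_fracPiece hf (SetLike.coe_mem (DirectSum.decompose 𝒜 b i))) n.natAbs)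
    have h2 : IsAlgebraic (Polynomial P) (ι f ^ j) := by
      obtain ⟨m, rfl | rfl⟩ := j.eq_nat_or_neg
      · rw [zpow_natCast]; exact halgf.pow m
      · rw [zpow_neg, zpow_natCast]; exact (halgf.pow m).inv
    have h3 := (halgP _ h1).mul h2
    rwa [mul_assoc, ← zpow_add₀ (algebraMap_fractionRing_ne_zero hf0), neg_add_cancel, zpow_zero,
      mul_one] at h3
  have : Algebra.IsAlgebraic (Polynomial P) K := by
    refine ⟨fun x => ?_⟩
    obtain ⟨b, c, _, rfl⟩ := IsFractionRing.div_surjective (A := B) x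
    rw [div_eq_mul_inv]
    exact (halgB b).mul (halgB c).inv
  obtain ⟨δ, hδ⟩ := Derivation.exists_extend_of_isAlgebraic hinj
    ((Algebra.linearMap (Polynomial P) K).compDer Differential.mapCoeffs)
  refine ⟨δ, ?_, fun p => ?_⟩
  · rw [← hX, hδ]
    change algebraMap (Polynomial P) K (Differential.mapCoeffs Polynomial.X) = 0
    rw [Differential.mapCoeffs_X, map_zero]
  · rw [← hC, hδ]
    change algebraMap (Polynomial P) K (Differential.mapCoeffs (Polynomial.C p)) = _
    rw [Differential.mapCoeffs_C, hC]
    rfl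

end Cylinder

/-! ### The derivation f^N δ on the Veronese subring. -/

section CylinderDerivation

variable {B : Type*} [CommRing B] {K : Type*} [Field K] [Algebra B K]
  [IsFractionRing B K] {𝒜 : ℤ → AddSubgroup B} [GradedRing 𝒜] {f : B} {n : ℤ} (hf : f ∈ 𝒜 n)

local notation "ι" => algebraMap B K

theorem Derivation.apply_zpow_of_eq_zero (δ : Derivation ℤ K K) {x : K} (hx : δ x = 0) (j : ℤ) :
    δ (x ^ j) = 0 := by
  obtain ⟨m, rfl | rfl⟩ := j.eq_nat_or_neg
  · rw [zpow_natCast, δ.apply_pow_of_eq_zero hx]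
  · rw [zpow_neg, zpow_natCast, δ.apply_inv_of_eq_zero (δ.apply_pow_of_eq_zero hx m)]

/-- The extended derivation has degree zero on `B[1/f]^(n)`. -/
theorem derivation_mem_fracPiece {δ : Derivation ℤ K K} (hδf : δ (ι f) = 0)
    {D : Derivation ℤ (fracSubring K hf) (fracSubring K hf)}
    (hδ : ∀ p : fracSubring K hf, δ p = D p)
    (hf0 : f ≠ 0) {i j : ℤ} (hij : j * n = i) {x : K}
    (hx : x ∈ fracPiece K hf i) : δ x ∈ fracPiece K hf i := by
  have hιf : ι f ≠ 0 := algebraMap_fractionRing_ne_zero hf0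
  have hp := mul_zpow_mem_fracSubring hf hf0 hij hx
  have hx' : x = ι f ^ j * (x * ι f ^ (-j)) := by
    rw [mul_left_comm, ← zpow_add₀ hιf, add_neg_cancel, zpow_zero, mul_one]
  rw [hx', δ.apply_mul_of_left_eq_zero (δ.apply_zpow_of_eq_zero hδf j), hδ ⟨_, hp⟩]
  have := mul_mem_fracPiece hf (zpow_mem_fracPiece (K := K) hf hf0 j) (D ⟨_, hp⟩).2
  rwa [add_zero, hij] at this

theorem iterate_pow_smul_derivation {δ : Derivation ℤ K K} (hδf : δ (ι f) = 0)
    {D : Derivation ℤ (fracSubring K hf) (fracSubring K hf)}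
    (hδ : ∀ p : fracSubring K hf, δ p = D p)
    (hf0 : f ≠ 0) (N : ℕ) (j : ℤ) (p : fracSubring K hf) (l : ℕ) :
    (ι f ^ N • δ)^[l] (ι f ^ j * p) = ι f ^ (j + l * N) * (D^[l] p : fracSubring K hf) := by
  have hιf : ι f ≠ 0 := algebraMap_fractionRing_ne_zero hf0
  induction l with
  | zero => simp
  | succ l ih =>
    rw [Function.iterate_succ_apply', ih, Derivation.smul_apply,
      δ.apply_mul_of_left_eq_zero (δ.apply_zpow_of_eq_zero hδf _), hδ,
      Function.iterate_succ_apply', smul_eq_mul, ← mul_assoc, ← zpow_natCast, ← zpow_add₀ hιf]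
    congr 2
    push_cast; ring

theorem exists_iterate_eq_zero_of_mem_fracPiece {δ : Derivation ℤ K K} (hδf : δ (ι f) = 0)
    {D : Derivation ℤ (fracSubring K hf) (fracSubring K hf)}
    (hδ : ∀ p : fracSubring K hf, δ p = D p)
    (hf0 : f ≠ 0)
    (hD : IsLocallyNilpotentDerivation D) (N : ℕ) {i j : ℤ} (hij : j * n = i) {x : K}
    (hx : x ∈ fracPiece K hf i) : ∃ l : ℕ, (ι f ^ N • δ)^[l] x = 0 := by
  have hιf : ι f ≠ 0 := algebraMap_fractionRing_ne_zero hf0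
  have hp := mul_zpow_mem_fracSubring hf hf0 hij hx
  have hx' : x = ι f ^ j * (x * ι f ^ (-j)) := by
    rw [mul_left_comm, ← zpow_add₀ hιf, add_neg_cancel, zpow_zero, mul_one]
  obtain ⟨l, _, hl⟩ := hD ⟨_, hp⟩
  refine ⟨l, ?_⟩
  rw [hx', iterate_pow_smul_derivation hf hδf hδ hf0 N j ⟨_, hp⟩ l, hl]
  simp

/-- If δ killed all such numerators b, then D would kill every b/f^l. The witness has degree
divisible by n, so it shows nonvanishing on the Veronese subring and on B alike. -/
theorem exists_derivation_ne_zero {δ : Derivation ℤ K K} (hδf : δ (ι f) = 0)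
    {D : Derivation ℤ (fracSubring K hf) (fracSubring K hf)}
    (hδ : ∀ p : fracSubring K hf, δ p = D p)
    (hf0 : f ≠ 0) (hD : D ≠ 0) (N : ℕ) :
    ∃ l : ℕ, ∃ b ∈ 𝒜 (l * n), (ι f ^ N • δ) (ι b) ≠ 0 := by
  have hιf : ι f ≠ 0 := algebraMap_fractionRing_ne_zero hf0
  by_contra! hcon
  refine hD (Derivation.ext fun p => Subtype.ext ?_)
  obtain ⟨l, b, hb, hlb⟩ := p.2
  rw [zero_add] at hb
  have h := hcon l b hb
  rw [← hlb, Derivation.smul_apply, mul_comm,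
    δ.apply_mul_of_left_eq_zero (δ.apply_pow_of_eq_zero hδf l), hδ] at h
  simpa [hf0, hιf] using h

/-- Multiplied by a power of `f`, the extended derivation preserves the Veronese subring. -/
theorem exists_pow_smul_preserves_veronese {δ : Derivation ℤ K K} (hδf : δ (ι f) = 0)
    {D : Derivation ℤ (fracSubring K hf) (fracSubring K hf)}
    (hδ : ∀ p : fracSubring K hf, δ p = D p)
    {k : Type*} [Field k] [CharZero k] [Algebra k B]
    [Algebra.FiniteType k B] [IsDomain B] (hf0 : f ≠ 0) (hn : n ≠ 0)
    (hD : IsLocallyNilpotentDerivation D) :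
    ∃ N : ℕ, ∀ v ∈ veroneseSubring 𝒜 n.natAbs, ∃ w ∈ veroneseSubring 𝒜 n.natAbs,
      (ι f ^ N • δ) (ι v) = ι w := by
  classical
  have hBchar : CharZero B := charZero_of_injective_algebraMap (algebraMap k B).injective
  have hKchar : CharZero K := charZero_of_injective_algebraMap (IsFractionRing.injective B K)
  let V := veroneseSubring 𝒜 n.natAbs
  have hfV : f ∈ V := mem_veroneseSubring_of_dvd 𝒜 (Int.natAbs_dvd.2 dvd_rfl) hf
  have hk : ∀ c : k, δ (ι (algebraMap k B c)) = 0 := by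
    have hmem : ∀ c : k, ι (algebraMap k B c) ∈ fracSubring K hf := fun c =>
      algebraMap_mem_fracPiece hf (GradedRing.algebraMap_mem_zero 𝒜 c)
    intro c
    by_cases hc : c = 0
    · rw [hc, map_zero, map_zero, map_zero]
    · rw [hδ ⟨_, hmem c⟩, hD.apply_eq_zero_of_mul_eq_one (v := ⟨_, hmem c⁻¹⟩)]
      · rfl
      · exact Subtype.ext (by
          change ι (algebraMap k B c) * ι (algebraMap k B c⁻¹) = 1
          rw [← map_mul, ← map_mul, mul_inv_cancel₀ hc, map_one, map_one])
  have hmono : ∀ {M N : ℕ} {x : K}, M ≤ N → (∃ w ∈ V, ι f ^ M * x = ι w) →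
      ∃ w ∈ V, ι f ^ N * x = ι w := by
    rintro M N x hMN ⟨w, hw, h⟩
    obtain ⟨q, rfl⟩ := Nat.exists_eq_add_of_le' hMN
    exact ⟨f ^ q * w, mul_mem (pow_mem hfV q) hw, by
      rw [map_mul, ← h, map_pow, pow_add, mul_assoc]⟩
  have hlocal : ∀ v ∈ V, ∃ N : ℕ, ∃ w ∈ V, ι f ^ N * δ (ι v) = ι w := by
    intro v hv
    refine veroneseSubring_induction 𝒜
      (motive := fun v => ∃ N : ℕ, ∃ w ∈ V, ι f ^ N * δ (ι v) = ι w) hv ?_ ?_ ?_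
    · exact ⟨0, 0, zero_mem _, by simp⟩
    · rintro a b ⟨M, ha⟩ ⟨N, hb⟩
      obtain ⟨x, hx, hx'⟩ := hmono (le_max_left M N) ha
      obtain ⟨y, hy, hy'⟩ := hmono (le_max_right M N) hb
      exact ⟨max M N, x + y, add_mem hx hy, by rw [map_add, map_add, map_add, mul_add, hx', hy']⟩
    · intro i a ha
      obtain ⟨j, hj⟩ := exists_mul_eq_natAbs_mul n i
      obtain ⟨l, b, hb, h⟩ := derivation_mem_fracPiece hf hδf hδ hf0 hj
        (algebraMap_mem_fracPiece hf ha)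
      refine ⟨l, b, mem_veroneseSubring_of_dvd 𝒜 ?_ hb, by rw [mul_comm, h]⟩
      exact dvd_add (dvd_mul_right _ _) ((Int.natAbs_dvd.2 dvd_rfl).mul_left _)
  let _ : Algebra k V := veroneseAlgebra 𝒜 k n.natAbs
  have hft : Algebra.FiniteType k V := veroneseSubring_finiteType 𝒜 k (Int.natAbs_pos.2 hn)
  obtain ⟨S, hS⟩ := hft.out
  -- One exponent works for finitely many generators, and hence everywhere by the Leibniz rule and
  -- the vanishing of δ on scalars.
  obtain ⟨N, hN⟩ : ∃ N : ℕ, ∀ v ∈ S, ∃ w ∈ V, ι f ^ N * δ (ι (v : B)) = ι w := by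
    clear hS
    induction S using Finset.induction with
    | empty => exact ⟨0, by simp⟩
    | insert s S _ ih =>
      obtain ⟨M, hM⟩ := ih
      obtain ⟨E, hE⟩ := hlocal s s.2
      refine ⟨max M E, fun t ht => ?_⟩
      rcases Finset.mem_insert.1 ht with rfl | ht
      · exact hmono (le_max_right _ _) hE
      · exact hmono (le_max_left _ _) (hM t ht)
  refine ⟨N, fun v hv => ?_⟩
  have hv' : (⟨v, hv⟩ : V) ∈ Algebra.adjoin k (S : Set V) := hS ▸ Algebra.mem_top
  suffices H : ∀ v : V, v ∈ Algebra.adjoin k (S : Set V) →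
      ∃ w ∈ V, ι f ^ N * δ (ι (v : B)) = ι w from H ⟨v, hv⟩ hv'
  intro v hv
  induction hv using Algebra.adjoin_induction with
  | mem x hx => exact hN x hx
  | algebraMap c =>
    refine ⟨0, zero_mem _, ?_⟩
    change ι f ^ N * δ (ι (algebraMap k B c)) = _
    rw [hk, mul_zero, map_zero]
  | add x y _ _ hx hy =>
    obtain ⟨a, ha, ha'⟩ := hx
    obtain ⟨b, hb, hb'⟩ := hy
    exact ⟨a + b, add_mem ha hb, by
      rw [Subring.coe_add, map_add, map_add, map_add, mul_add, ha', hb']⟩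
  | mul x y _ _ hx hy =>
    obtain ⟨a, ha, ha'⟩ := hx
    obtain ⟨b, hb, hb'⟩ := hy
    refine ⟨x * b + y * a, add_mem (mul_mem x.2 hb) (mul_mem y.2 ha), ?_⟩
    rw [Subring.coe_mul, map_mul, Derivation.leibniz, map_add, map_mul, map_mul, ← ha', ← hb',
      smul_eq_mul, smul_eq_mul]
    ring

/-- The Veronese subring attached to the degree of a cylinder is not rigid. -/
theorem not_isRigidRing_veroneseSubring_of_derivation {δ : Derivation ℤ K K} (hδf : δ (ι f) = 0)
    {D : Derivation ℤ (fracSubring K hf) (fracSubring K hf)}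
    (hδ : ∀ p : fracSubring K hf, δ p = D p)
    (hf0 : f ≠ 0) (hn : n ≠ 0)
    (hD : IsLocallyNilpotentDerivation D) (hD0 : D ≠ 0) {N : ℕ}
    (hN : ∀ v ∈ veroneseSubring 𝒜 n.natAbs, ∃ w ∈ veroneseSubring 𝒜 n.natAbs,
      (ι f ^ N • δ) (ι v) = ι w) : ¬ IsRigidRing (veroneseSubring 𝒜 n.natAbs) := by
  let V := veroneseSubring 𝒜 n.natAbs
  have hn' : (n.natAbs : ℤ) ≠ 0 := by exact_mod_cast Int.natAbs_ne_zero.2 hn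
  have hinj : Function.Injective (algebraMap V K) :=
    (IsFractionRing.injective B K).comp Subtype.val_injective
  obtain ⟨E, hE⟩ := Derivation.exists_restrict (V := V) (K := K) hinj (ι f ^ N • δ) fun v => by
    obtain ⟨w, hw, h⟩ := hN v v.2
    exact ⟨⟨w, hw⟩, h⟩
  have hiter : ∀ (l : ℕ) (v : V),
      algebraMap V K (E^[l] v) = (ι f ^ N • δ)^[l] (algebraMap V K v) := by
    intro l
    induction l with
    | zero => exact fun v => rfl
    | succ l ih => intro v; rw [Function.iterate_succ_apply, ih, hE, Function.iterate_succ_apply]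
  intro hrigid
  let _ : GradedRing (veroneseGrading 𝒜 n.natAbs) := veroneseGradedRing 𝒜 hn'
  have hE0 := hrigid E (isLocallyNilpotentDerivation_of_homogeneous
    (veroneseGrading 𝒜 n.natAbs) E fun i v hv => by
      obtain ⟨j, hj⟩ := exists_mul_eq_natAbs_mul n i
      obtain ⟨l, hl⟩ := exists_iterate_eq_zero_of_mem_fracPiece hf hδf hδ hf0 hD N hj
        (algebraMap_mem_fracPiece hf ((mem_veroneseGrading 𝒜).1 hv))
      refine ⟨l, hinj ?_⟩
      rw [hiter, map_zero]
      exact hl)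
  obtain ⟨l, b, hb, hne⟩ := exists_derivation_ne_zero hf hδf hδ hf0 hD0 N
  have hbV : b ∈ V := mem_veroneseSubring_of_dvd 𝒜 ((Int.natAbs_dvd.2 dvd_rfl).mul_left _) hb
  refine hne ?_
  have := hE ⟨b, hbV⟩
  rw [hE0, Derivation.coe_zero, Pi.zero_apply, map_zero] at this
  exact this.symm

end CylinderDerivation

/-! ### Saturation in codimension one and extension to B. -/

section Saturation

variable {B : Type*} [CommRing B] {𝒜 : ℤ → AddSubgroup B} [GradedRing 𝒜]

/-- If `B / p` has the same saturation index as `B`, then outside `p` there are homogeneous elements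
of every degree that occurs in `B`, modulo `d`. -/
theorem exists_notMem_degree_modEq {p : Ideal B} (hp : p.IsPrime)
    (hsat : saturationIndex (quotientGrading 𝒜 p) = saturationIndex 𝒜) {d : ℕ} (hd : 1 ≤ d)
    {i : ℤ} (hi : 𝒜 i ≠ ⊥) : ∃ j, ∃ z ∈ 𝒜 j, z ∉ p ∧ (d : ℤ) ∣ i + j := by
  -- Negatives of degrees occurring outside p, modulo d. Closure under negation uses z^(d-1), whose
  -- degree is -deg z modulo d.
  let H : AddSubgroup ℤ :=
    { carrier := {l | ∃ j, (d : ℤ) ∣ l + j ∧ ∃ z ∈ 𝒜 j, z ∉ p}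
      zero_mem' := ⟨0, by simp, 1, SetLike.GradedOne.one_mem, p.ne_top_iff_one.1 hp.ne_top⟩
      add_mem' := by
        rintro a b ⟨j, hj, z, hz, hzp⟩ ⟨l, hl, w, hw, hwp⟩
        refine ⟨j + l, ?_, z * w, SetLike.GradedMul.mul_mem hz hw, hp.mul_notMem hzp hwp⟩
        rw [add_add_add_comm]
        exact dvd_add hj hl
      neg_mem' := by
        rintro a ⟨j, hj, z, hz, hzp⟩
        refine ⟨(d - 1 : ℕ) * j, ?_, z ^ (d - 1), ?_, fun h => hzp (hp.mem_of_pow_mem _ h)⟩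
        · rw [Nat.cast_sub hd]
          have h := dvd_sub (dvd_mul_right (d : ℤ) j) hj
          rwa [show (d : ℤ) * j - (a + j) = -a + ((d : ℤ) - (1 : ℕ)) * j by push_cast; ring] at h
        · have := SetLike.pow_mem_graded (d - 1) hz
          rwa [nsmul_eq_mul] at this }
  obtain ⟨q, hq⟩ := Int.subgroup_cyclic H
  rw [← AddSubgroup.zmultiples_eq_closure] at hq
  have hqH : ∀ l : ℤ, l ∈ H ↔ q ∣ l := fun l => by rw [hq, Int.mem_zmultiples_iff]
  -- The generator q of H divides every degree of B/p, hence e(B/p) = e(B), hence every degree of B.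
  have hqsat : q ∣ (saturationIndex 𝒜 : ℤ) := by
    rw [← hsat, dvd_saturationIndex_iff]
    intro l hl
    obtain ⟨⟨_, z, hz, rfl⟩, hz0⟩ := AddSubgroup.ne_bot_iff_exists_ne_zero.1 hl
    rw [← hqH, ← neg_mem_iff]
    refine ⟨l, by simp, z, hz, fun hzp => hz0 (Subtype.ext ?_)⟩
    exact Ideal.Quotient.eq_zero_iff_mem.2 hzp
  obtain ⟨j, hj, z, hz, hzp⟩ := (hqH i).2 ((dvd_saturationIndex_iff 𝒜 q).1 hqsat i hi)
  exact ⟨j, z, hz, hzp, hj⟩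

variable [IsDomain B] {K : Type*} [Field K] [Algebra B K] [IsFractionRing B K]

local notation "ι" => algebraMap B K

/-- For `B` normal and saturated in codimension one, a derivation of the fraction field that maps a
Veronese subring into `B` maps `B` into `B`. -/
theorem derivation_mem_range_of_isSaturatedInCodimOne [IsNoetherianRing B] [IsIntegrallyClosed B]
    [CharZero K] (hdinv : ∀ d : ℕ, d ≠ 0 → (d : K)⁻¹ ∈ (ι).range)
    (hsat : IsSaturatedInCodimOne 𝒜) {d : ℕ} (hd : 1 ≤ d) (Δ : Derivation ℤ K K)
    (hΔ : ∀ v ∈ veroneseSubring 𝒜 d, Δ (ι v) ∈ (ι).range) (b : B) : Δ (ι b) ∈ (ι).range := by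
  classical
  suffices H : ∀ i, ∀ b ∈ 𝒜 i, Δ (ι b) ∈ (ι).range by
    rw [← DirectSum.sum_support_decompose 𝒜 b, map_sum, map_sum]
    exact sum_mem fun i _ => H i _ (SetLike.coe_mem _)
  intro i b hb
  by_contra hcon
  have hb0 : b ≠ 0 := by
    rintro rfl
    exact hcon (by rw [map_zero, map_zero]; exact zero_mem _)
  obtain ⟨p, hp, hht, hden⟩ := exists_prime_height_one_of_notMem_range hcon
  obtain ⟨j, z, hz, hzp, hdvd⟩ : ∃ j, ∃ z ∈ 𝒜 j, z ∉ p ∧ (d : ℤ) ∣ i + j := by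
    by_cases hhom : p.IsHomogeneous 𝒜
    · refine exists_notMem_degree_modEq hp (hsat p hp hhom hht) hd fun hbot => hb0 ?_
      rwa [hbot, AddSubgroup.mem_bot] at hb
    -- The homogeneous core is a prime strictly below a prime of height one, hence zero, so p
    -- contains no nonzero homogeneous element. Then z = b^(d-1) works, as i + (d-1)i = di.
    · have hcore := hp.homogeneousCore (𝒜 := 𝒜)
      have hlt : (p.homogeneousCore 𝒜).toIdeal < p := by
        refine lt_of_le_of_ne (Ideal.toIdeal_homogeneousCore_le 𝒜 p) fun h => hhom ?_
        rw [← h]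
        exact (p.homogeneousCore 𝒜).isHomogeneous
      have hbot : (p.homogeneousCore 𝒜).toIdeal = ⊥ := by
        have h1 := Ideal.height_add_one_le_of_lt_of_isPrime hlt
        rw [hht] at h1
        rw [← Ideal.height_eq_zero_iff_eq_bot]
        exact Order.lt_one_iff.1 ((ENat.add_one_le_iff' ENat.one_ne_top).1 h1)
      have hnot : ∀ l, ∀ z ∈ 𝒜 l, z ≠ 0 → z ∉ p := by
        intro l z hz hz0 hzp
        refine hz0 ?_
        rw [← Ideal.mem_bot, ← hbot]
        exact Ideal.mem_homogeneousCore_of_homogeneous_of_mem ⟨l, hz⟩ hzp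
      have hz := SetLike.pow_mem_graded (d - 1) hb
      refine ⟨_, b ^ (d - 1), hz, hnot _ _ hz (pow_ne_zero _ hb0), ?_⟩
      rw [nsmul_eq_mul, Nat.cast_sub hd]
      exact ⟨i, by push_cast; ring⟩
  have hbz : Δ (ι (b * z)) ∈ (ι).range :=
    hΔ _ (mem_veroneseSubring_of_dvd 𝒜 hdvd (SetLike.GradedMul.mul_mem hb hz))
  -- Δz itself need not lie in B, but z^d is in the Veronese subring and Δ(z^d) = d z^(d-1) Δz.
  have hzd : ι z ^ (d - 1) * Δ (ι z) ∈ (ι).range := by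
    have h1 := hΔ _ (pow_mem_veroneseSubring 𝒜 (d := d) hz)
    rw [map_pow, Derivation.leibniz_pow, smul_eq_mul, nsmul_eq_mul] at h1
    have h2 := mul_mem (hdinv d (by omega)) h1
    rwa [inv_mul_cancel_left₀ (Nat.cast_ne_zero.2 (by omega))] at h2
  refine hzp (hp.mem_of_pow_mem d (hden _ ?_))
  have h3 : ι (z ^ d) * Δ (ι b) =
      ι (z ^ (d - 1)) * Δ (ι (b * z)) - ι b * (ι z ^ (d - 1) * Δ (ι z)) := by
    obtain ⟨d', rfl⟩ := Nat.exists_eq_add_of_le' hd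
    rw [Nat.add_sub_cancel, map_mul ι b z, Derivation.leibniz, map_pow, map_pow, smul_eq_mul,
      smul_eq_mul, pow_succ]
    ring
  rw [h3]
  exact sub_mem (mul_mem ⟨_, rfl⟩ hbz) (mul_mem ⟨_, rfl⟩ hzd)

end Saturation

/-! ### Local nilpotency on B, and the theorem. -/

section NonRigid

variable {B : Type*} [CommRing B] [IsDomain B] {K : Type*} [Field K] [Algebra B K]
  [IsFractionRing B K] {𝒜 : ℤ → AddSubgroup B} [GradedRing 𝒜] {f : B} {n : ℤ} (hf : f ∈ 𝒜 n)

local notation "ι" => algebraMap B K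

/-- An extension to `B` of the derivation of the Veronese subring along a cylinder is nilpotent on
homogeneous elements. -/
theorem exists_iterate_eq_zero_of_homogeneous [CharZero K] {A : Type*} [CommRing A]
    (φ : fracSubring K hf ≃+* Polynomial A) {δ : Derivation ℤ K K}
    (hδf : δ (algebraMap B K f) = 0)
    (hδ : ∀ p : fracSubring K hf, δ p = φ.polynomialDerivation p)
    (hf0 : f ≠ 0) (hn : n ≠ 0) (N : ℕ) (hΔ : ∀ b : B, (ι f ^ N • δ) (ι b) ∈ (ι).range)
    {i : ℤ} {c : B} (hc : c ∈ 𝒜 i) : ∃ l : ℕ, (ι f ^ N • δ)^[l] (ι c) = 0 := by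
  have hιf : ι f ≠ 0 := algebraMap_fractionRing_ne_zero hf0
  let g : A →+* K := (fracSubring K hf).subtype.comp (φ.symm.toRingHom.comp Polynomial.C)
  have hg : Function.Injective g :=
    Subtype.val_injective.comp (φ.symm.injective.comp Polynomial.C_injective)
  have hA : NoZeroDivisors A := hg.noZeroDivisors g (map_zero g) (map_mul g)
  set d := n.natAbs with hd_def
  obtain ⟨d', hd'⟩ : ∃ d', d = d' + 1 := Nat.exists_eq_add_one.2 (Int.natAbs_pos.2 hn)
  have hdK : (d : K) ≠ 0 := Nat.cast_ne_zero.2 (by omega)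
  set Δ := ι f ^ N • δ with hΔ_def
  have hΔapp : ∀ x, Δ x = ι f ^ N * δ x := fun x => rfl
  have hpow : ∀ x : K, Δ (x ^ d) = d * x ^ d' * Δ x := by
    intro x
    rw [Derivation.leibniz_pow, smul_eq_mul, nsmul_eq_mul, hd', Nat.add_sub_cancel, mul_assoc]
  have hΔp : ∀ (j : ℤ) (p : fracSubring K hf),
      Δ (ι f ^ j * p) = ι f ^ (j + N) * (φ.polynomialDerivation p : fracSubring K hf) := by
    intro j p
    rw [hΔapp, δ.apply_mul_of_left_eq_zero (δ.apply_zpow_of_eq_zero hδf j), hδ, ← mul_assoc,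
      ← zpow_natCast, ← zpow_add₀ hιf, add_comm]
  -- Homogeneity is known for Δ(c^d) = d c^(d-1) Δc, and passes to the factor Δc.
  have hdeg : ∀ (i : ℤ) (c c' : B), c ∈ 𝒜 i → Δ (ι c) = ι c' → c ≠ 0 → c' ∈ 𝒜 (i + N * n) := by
    intro i c c' hc hcc' hc0
    by_cases hc'0 : c' = 0
    · rw [hc'0]; exact zero_mem _
    obtain ⟨j, hj⟩ := exists_mul_eq_natAbs_mul n i
    have h1 := derivation_mem_fracPiece hf hδf hδ hf0 hj
      (pow_mem_fracPiece hf (algebraMap_mem_fracPiece hf hc) d)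
    have h2 := mul_mem_fracPiece hf
      (pow_mem_fracPiece (K := K) hf (algebraMap_mem_fracPiece hf hf) N) h1
    rw [← hΔapp, hpow, hcc'] at h2
    have hcast : ((d : K) * ι c ^ d' * ι c') = ι (c' * ((d : B) * c ^ d')) := by
      simp only [map_mul, map_pow, map_natCast]; ring
    rw [hcast] at h2
    have h3 := mem_of_algebraMap_mem_fracPiece hf hf0 h2
    have hdB : (d : B) ≠ 0 := fun h => hdK (by rw [← map_natCast ι, h, map_zero])
    have h4 : c' * ((d : B) * c ^ d') ≠ 0 := mul_ne_zero hc'0 (mul_ne_zero hdB (pow_ne_zero _ hc0))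
    obtain ⟨i', hi'⟩ := GradedRing.exists_mem_of_mul_mem 𝒜 h3 h4
    have h5 : (d : B) ∈ 𝒜 0 := SetLike.natCast_mem_graded 𝒜 d
    have h6 := SetLike.GradedMul.mul_mem hi'
      (SetLike.GradedMul.mul_mem h5 (SetLike.pow_mem_graded d' hc))
    have h7 := GradedRing.degree_eq 𝒜 h3 h6 h4
    have h8 : i' = i + N * n := by
      rw [← hd_def, hd', nsmul_eq_mul] at h7
      push_cast at h7
      linarith
    exact h8 ▸ hi'
  -- Writing c^d = f^j p with p in B_(f), the induction is on the t-degree of p.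
  suffices H : ∀ (q : ℕ) (i j : ℤ) (c : B) (p : fracSubring K hf), c ∈ 𝒜 i → c ≠ 0 →
      j * n = d * i → ι c ^ d = ι f ^ j * p → (φ p).natDegree ≤ q → ∃ l : ℕ, Δ^[l] (ι c) = 0 by
    by_cases hc0 : c = 0
    · exact ⟨0, by simp [hc0]⟩
    obtain ⟨j, hj⟩ := exists_mul_eq_natAbs_mul n i
    have hp := mul_zpow_mem_fracSubring hf hf0 hj
      (pow_mem_fracPiece (K := K) hf (algebraMap_mem_fracPiece hf hc) d)
    refine H _ i j c ⟨_, hp⟩ hc hc0 hj ?_ le_rfl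
    change ι c ^ d = ι f ^ j * (ι c ^ d * ι f ^ (-j))
    rw [mul_left_comm, ← zpow_add₀ hιf, add_neg_cancel, zpow_zero, mul_one]
  intro q
  induction q using Nat.strong_induction_on with
  | _ q ih =>
  intro i j c p hc hc0 hj hcp hq
  have hιc : ι c ≠ 0 := algebraMap_fractionRing_ne_zero hc0
  have h1 : (d : K) * ι c ^ d' * Δ (ι c) =
      ι f ^ (j + N) * (φ.polynomialDerivation p : fracSubring K hf) := by
    rw [← hpow, hcp, hΔp]
  obtain ⟨c', hc'⟩ := hΔ (c)
  by_cases hc'0 : c' = 0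
  · exact ⟨1, by rw [Function.iterate_one, ← hc', hc'0, map_zero]⟩
  have hc'mem := hdeg i c c' hc hc'.symm hc0
  have hj' : (j + d * N) * n = d * (i + N * n) := by linear_combination hj
  have hp' := mul_zpow_mem_fracSubring hf hf0 hj'
    (pow_mem_fracPiece (K := K) hf (algebraMap_mem_fracPiece hf hc'mem) d)
  obtain ⟨p', hp'_def⟩ : ∃ p' : fracSubring K hf, ι c' ^ d = ι f ^ (j + d * N) * p' := by
    refine ⟨⟨_, hp'⟩, ?_⟩
    change ι c' ^ d = ι f ^ (j + d * N) * (ι c' ^ d * ι f ^ (-(j + d * N)))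
    rw [mul_left_comm, ← zpow_add₀ hιf, add_neg_cancel, zpow_zero, mul_one]
  -- The d-th power of d c^(d-1) Δc = f^(j+N) ∂p, with the powers of f cancelled. Comparing degrees
  -- in t gives deg p' ≤ deg p - d.
  have hrel : (d : fracSubring K hf) ^ d * p ^ d' * p' = φ.polynomialDerivation p ^ d := by
    apply Subtype.ext
    push_cast
    have h2 := congrArg (· ^ d) h1
    simp only [mul_pow, ← hc'] at h2
    rw [hp'_def, ← pow_mul, mul_comm d' d, pow_mul, hcp, mul_pow] at h2
    have h3 : (ι f ^ j) ^ d' * ι f ^ (j + d * N) = (ι f ^ (j + N)) ^ d := by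
      rw [← zpow_natCast, ← zpow_natCast, ← zpow_mul, ← zpow_mul, ← zpow_add₀ hιf, hd']
      congr 1
      push_cast; ring
    apply mul_left_cancel₀ (pow_ne_zero d (zpow_ne_zero (j + N) hιf))
    rw [← h2, ← h3]
    ring
  have hp'0 : p' ≠ 0 := by
    rintro rfl
    rw [ZeroMemClass.coe_zero, mul_zero] at hp'_def
    exact pow_ne_zero d (algebraMap_fractionRing_ne_zero (K := K) hc'0) hp'_def
  have hp0 : p ≠ 0 := by
    rintro rfl
    rw [ZeroMemClass.coe_zero, mul_zero] at hcp
    exact pow_ne_zero d hιc hcp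
  have hder0 : Polynomial.derivative (φ p) ≠ 0 := by
    intro h0
    have h2 : φ.polynomialDerivation p = 0 := φ.injective (by
      rw [φ.map_polynomialDerivation, h0, map_zero])
    rw [h2, ZeroMemClass.coe_zero, mul_zero, ← hc'] at h1
    exact mul_ne_zero (mul_ne_zero hdK (pow_ne_zero _ hιc))
      (algebraMap_fractionRing_ne_zero hc'0) h1
  have hq0 : (φ p).natDegree ≠ 0 := fun h => hder0 (Polynomial.derivative_of_natDegree_zero h)
  have hdegp : d' * (φ p).natDegree + (φ p').natDegree ≤ d * ((φ p).natDegree - 1) := by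
    have h2 := congrArg (fun x => (φ x).natDegree) hrel
    simp only [map_mul, map_pow, map_natCast, φ.map_polynomialDerivation] at h2
    have hdA : ((d : Polynomial A)) ^ d ≠ 0 := by
      refine pow_ne_zero _ fun h => hdK ?_
      have h5 : (d : fracSubring K hf) = 0 := φ.injective (by rw [map_natCast, h, map_zero])
      exact_mod_cast congrArg Subtype.val h5
    have hφp : φ p ≠ 0 := (map_ne_zero_iff φ φ.injective).2 hp0
    have hφp' : φ p' ≠ 0 := (map_ne_zero_iff φ φ.injective).2 hp'0
    rw [Polynomial.natDegree_mul (mul_ne_zero hdA (pow_ne_zero _ hφp)) hφp',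
      Polynomial.natDegree_mul hdA (pow_ne_zero _ hφp), Polynomial.natDegree_pow,
      Polynomial.natDegree_pow, Polynomial.natDegree_natCast, mul_zero, zero_add,
      Polynomial.natDegree_pow] at h2
    rw [h2]
    exact Nat.mul_le_mul_left d (Polynomial.natDegree_derivative_le _)
  have hlt : (φ p').natDegree < (φ p).natDegree := by
    obtain ⟨m, hm⟩ := Nat.exists_eq_succ_of_ne_zero hq0
    rw [hm, hd'] at hdegp
    rw [hm]
    simp only [Nat.succ_eq_add_one, Nat.add_sub_cancel] at hdegp ⊢
    nlinarith
  obtain ⟨l, hl⟩ := ih _ (hlt.trans_le hq) (i + N * n) (j + d * N) c' p' hc'mem hc'0 hj' hp'_def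
    le_rfl
  exact ⟨l + 1, by rw [Function.iterate_succ_apply, ← hc', hl]⟩

end NonRigid

/-- A cylindrical element makes a Veronese subring, and under normality and saturation the ring
itself, non-rigid. -/
theorem IsCylindrical.not_isRigidRing {k B : Type*} [Field k] [CharZero k] [CommRing B]
    [IsDomain B] [Algebra k B] [Algebra.FiniteType k B] {𝒜 : ℤ → AddSubgroup B} [GradedRing 𝒜]
    (K : Type*) [Field K] [Algebra B K] [IsFractionRing B K] {f : B}
    (hcyl : IsCylindrical 𝒜 f) :
    (∃ d : ℕ, 1 ≤ d ∧ ¬ IsRigidRing (veroneseSubring 𝒜 d)) ∧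
      (IsSaturatedInCodimOne 𝒜 → IsIntegrallyClosed B → ¬ IsRigidRing B) := by
  have hBchar : CharZero B := charZero_of_injective_algebraMap (algebraMap k B).injective
  have hKchar : CharZero K := charZero_of_injective_algebraMap (IsFractionRing.injective B K)
  have hnoeth : IsNoetherianRing B := Algebra.FiniteType.isNoetherianRing k B
  obtain ⟨hf0, ⟨n, hn, hf⟩, hpoly⟩ := hcyl
  rw [isPolynomialRingInOneVariable_away_iff K hf hf0] at hpoly
  obtain ⟨A, ⟨φ₀⟩⟩ := hpoly
  let φ : fracSubring K hf ≃+* Polynomial A := φ₀.toRingEquiv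
  let D := φ.polynomialDerivation
  have hD : IsLocallyNilpotentDerivation D := φ.polynomialDerivation_isLocallyNilpotent
  have hD0 : D ≠ 0 := by
    intro h
    have h1 := φ.map_polynomialDerivation (φ.symm Polynomial.X)
    change φ (D _) = _ at h1
    rw [h, Derivation.coe_zero, Pi.zero_apply, map_zero, φ.apply_symm_apply,
      Polynomial.derivative_X] at h1
    have h2 := congrArg φ.symm h1
    rw [map_zero, map_one] at h2
    exact zero_ne_one h2
  obtain ⟨δ, hδf, hδ⟩ := exists_derivation_extending hf hf0 hn D
  obtain ⟨N, hN⟩ := exists_pow_smul_preserves_veronese (k := k) hf hδf hδ hf0 hn hD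
  refine ⟨⟨n.natAbs, Int.natAbs_pos.2 hn,
    not_isRigidRing_veroneseSubring_of_derivation hf hδf hδ hf0 hn hD hD0 hN⟩,
    fun hsat hnormal hrigid => ?_⟩
  have hdinv : ∀ d : ℕ, d ≠ 0 → (d : K)⁻¹ ∈ (algebraMap B K).range := by
    intro d hd
    refine ⟨algebraMap k B (d : k)⁻¹, eq_inv_of_mul_eq_one_left ?_⟩
    rw [← map_natCast (algebraMap B K) d, ← map_natCast (algebraMap k B) d, ← map_mul, ← map_mul,
      inv_mul_cancel₀ (Nat.cast_ne_zero.2 hd), map_one, map_one]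
  have hΔ := derivation_mem_range_of_isSaturatedInCodimOne (K := K) hdinv hsat
    (Int.natAbs_pos.2 hn) (algebraMap B K f ^ N • δ) fun v hv => by
      obtain ⟨w, _, h⟩ := hN v hv
      exact ⟨w, h.symm⟩
  obtain ⟨E, hE⟩ := Derivation.exists_restrict (V := B) (K := K) (IsFractionRing.injective B K)
    (algebraMap B K f ^ N • δ) fun b => (hΔ b).imp fun _ h => h.symm
  have hiter : ∀ (l : ℕ) (b : B),
      algebraMap B K (E^[l] b) = (algebraMap B K f ^ N • δ)^[l] (algebraMap B K b) := by
    intro l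
    induction l with
    | zero => exact fun b => rfl
    | succ l ih => intro b; rw [Function.iterate_succ_apply, ih, hE, Function.iterate_succ_apply]
  have hE0 := hrigid E (isLocallyNilpotentDerivation_of_homogeneous 𝒜 E fun i b hb => by
    obtain ⟨l, hl⟩ := exists_iterate_eq_zero_of_homogeneous hf φ hδf hδ hf0 hn N hΔ hb
    exact ⟨l, IsFractionRing.injective B K (by rw [hiter, hl, map_zero])⟩)
  obtain ⟨l, b, _, hne⟩ := exists_derivation_ne_zero hf hδf hδ hf0 hD0 N
  refine hne ?_
  rw [← hE, hE0, Derivation.coe_zero, Pi.zero_apply, map_zero]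

theorem IsRigidRing.of_ringEquiv {R S : Type*} [CommRing R] [CommRing S] (e : R ≃+* S)
    (h : IsRigidRing R) : IsRigidRing S := by
  intro D hD
  let E : Derivation ℤ R R := Derivation.mk'
    ((e.symm.toAddMonoidHom.comp (D : S →+ S)).comp e.toAddMonoidHom).toIntLinearMap fun a b => by
      change e.symm (D (e (a * b))) = a * e.symm (D (e b)) + b * e.symm (D (e a))
      rw [map_mul, Derivation.leibniz, map_add, smul_eq_mul, smul_eq_mul, map_mul, map_mul,
        e.symm_apply_apply, e.symm_apply_apply]
  have hE : ∀ a, e (E a) = D (e a) := fun a => e.apply_symm_apply _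
  have hiter : ∀ (n : ℕ) a, e (E^[n] a) = D^[n] (e a) := by
    intro n
    induction n with
    | zero => exact fun a => rfl
    | succ n ih => intro a; rw [Function.iterate_succ_apply, ih, hE, Function.iterate_succ_apply]
  have hE0 := h E fun a => by
    obtain ⟨n, hn, h1⟩ := hD (e a)
    exact ⟨n, hn, e.injective (by rw [hiter, h1, map_zero])⟩
  ext s
  have := hE (e.symm s)
  rw [hE0, e.apply_symm_apply] at this
  simpa using this.symm

theorem mainTheorem1 {k B : Type*} [Field k] [CharZero k] [CommRing B] [IsDomain B]
    [Algebra k B] [Algebra.FiniteType k B] (𝒜 : ℤ → AddSubgroup B) [GradedRing 𝒜]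
    (hB : 2 ≤ Algebra.trdeg (SetLike.GradeZero.subring 𝒜) B ∨
      ∃ i j : ℤ, i < 0 ∧ 0 < j ∧ 𝒜 i ≠ ⊥ ∧ 𝒜 j ≠ ⊥) :
    ((∃ d : ℕ, 1 ≤ d ∧ ¬ IsRigidRing (veroneseSubring 𝒜 d)) ↔ ∃ f : B, IsCylindrical 𝒜 f) ∧
    (IsSaturatedInCodimOne 𝒜 → IsIntegrallyClosed B →
      List.TFAE [
        ∃ d : ℕ, 1 ≤ d ∧ ¬ IsRigidRing (veroneseSubring 𝒜 d),
        ∃ f : B, IsCylindrical 𝒜 f,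
        ¬ IsRigidRing B]) := by
  have hab : (∃ d : ℕ, 1 ≤ d ∧ ¬ IsRigidRing (veroneseSubring 𝒜 d)) →
      ∃ f : B, IsCylindrical 𝒜 f := fun ⟨d, hd, h⟩ =>
    exists_isCylindrical_of_not_isRigidRing (k := k) (FractionRing B) hB hd h
  have hba : (∃ f : B, IsCylindrical 𝒜 f) →
      ∃ d : ℕ, 1 ≤ d ∧ ¬ IsRigidRing (veroneseSubring 𝒜 d) := fun ⟨f, hf⟩ =>
    (hf.not_isRigidRing (k := k) (FractionRing B)).1
  refine ⟨⟨hab, hba⟩, fun hsat hnormal => ?_⟩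
  tfae_have 1 → 2 := hab
  tfae_have 2 → 3 := fun ⟨f, hf⟩ =>
    (hf.not_isRigidRing (k := k) (FractionRing B)).2 hsat hnormal
  tfae_have 3 → 1 := by
    refine fun h => ⟨1, le_rfl, fun hrigid => h ?_⟩
    have htop : veroneseSubring 𝒜 ((1 : ℕ) : ℤ) = ⊤ := by
      classical
      refine eq_top_iff.2 fun b _ => ?_
      rw [← DirectSum.sum_support_decompose 𝒜 b]
      exact sum_mem fun i _ => mem_veroneseSubring_of_dvd 𝒜 (by simp) (SetLike.coe_mem _)
    exact hrigid.of_ringEquiv ((RingEquiv.subringCongr htop).trans Subring.topEquiv)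
  tfae_finish
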